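/- Let $z\in\mathbb{C}$, let $\alpha,\beta>0$ with $\alpha\beta=1$, and let $\chi$ be a real primitive Dirichlet character modulo $q>1$. Put $a=0$ if $\chi$ is even ($\chi(-1)=1$), $a=1$ if $\chi$ is odd ($\chi(-1)=-1$), and $$\xi(s,\chi)=\left(\frac{\pi}{q}\right)^{-\frac{s+a}{2}}\Gamma\left(\frac{s+a}{2}\right)L(s,\chi),\qquad \Xi(t,\chi)=\xi\left(\tfrac12+it,\chi\right),\qquad W_\chi(x)=\frac{\sum_{r=1}^{q-1}\chi(r)e^{-2\pi rx/q}}{1-e^{-2\pi x}}.$$ With Kummer's confluent hypergeometric function ${}_1F_1(a;c;w)=\sum_{n\ge0}\frac{(a)_n}{(c)_n}\frac{w^n}{n!}$, where $(a)_n=a(a+1)\cdots(a+n-1)$, put $$\omega(x,z,s)=x^{\frac12-s}e^{-\frac{z^2}{8}}{}_1F_1\left(1-\tfrac s2;\tfrac32;\tfrac{z^2}{4}\right),\qquad \Delta(x,z,s)=\omega(x,z,s)+\omega(x,z,1-s),$$ $$\rho(x,z,s)=x^{\frac12-s}e^{-\frac{z^2}{8}}{}_1F_1\left(\tfrac{1-s}{2};\tfrac12;\tfrac{z^2}{4}\right),\qquad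 \nabla(x,z,s)=\rho(x,z,s)+\rho(x,z,1-s).$$ (i) If $\chi$ is even, then $$\begin{aligned}&\sqrt{\alpha}\,e^{\frac{z^2}{8}}\int_0^\infty e^{-\frac{\pi\alpha^2x^2}{q}}\sin\left(\frac{\sqrt\pi\,\alpha xz}{\sqrt q}\right)W_\chi(x)\,dx=\sqrt{\beta}\,e^{-\frac{z^2}{8}}\int_0^\infty e^{-\frac{\pi\beta^2x^2}{q}}\sinh\left(\frac{\sqrt\pi\,\beta xz}{\sqrt q}\right)W_\chi(x)\,dx\\&\qquad=\frac{z\sqrt q}{16\pi^2}\int_0^\infty\Gamma\left(\frac{3+it}{4}\right)\Gamma\left(\frac{3-it}{4}\right)\Xi\left(\frac t2,\chi\right)\Delta\left(\alpha,z,\frac{1+it}{2}\right)dt.\end{aligned}$$ (ii) If $\chi$ is odd, then $$\begin{aligned}&\sqrt{\alpha}\,e^{\frac{z^2}{8}}\int_0^\infty e^{-\frac{\pi\alpha^2x^2}{q}}\cos\left(\frac{\sqrt\pi\,\alpha xz}{\sqrt q}\right)W_\chi(x)\,dx=\sqrt{\beta}\,e^{-\frac{z^2}{8}}\int_0^\infty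 e^{-\frac{\pi\beta^2x^2}{q}}\cosh\left(\frac{\sqrt\pi\,\beta xz}{\sqrt q}\right)W_\chi(x)\,dx\\&\qquad=\frac{1}{16\pi^{3/2}}\int_0^\infty\Gamma\left(\frac{1+it}{4}\right)\Gamma\left(\frac{1-it}{4}\right)\Xi\left(\frac t2,\chi\right)\nabla\left(\alpha,z,\frac{1+it}{2}\right)dt.\end{aligned}$$ All the integrals converge absolutely. -/

import Mathlib

open MeasureTheory Set

namespace CharXi

/-- Kummer's confluent hypergeometric function
`₁F₁(a; c; w) = ∑ₙ (a)ₙ / (c)ₙ * wⁿ / n!`, where `(a)ₙ = a (a + 1) ⋯ (a + n - 1)`.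
The series converges for all `a, w` when `c` is not a non-positive integer. -/
noncomputable def kummer (a c w : ℂ) : ℂ :=
  ∑' n : ℕ, (ascPochhammer ℂ n).eval a / (ascPochhammer ℂ n).eval c * (w ^ n / (n.factorial : ℂ))

/-- `ω(x, z, s) = x^{1/2 - s} e^{-z²/8} ₁F₁(1 - s/2; 3/2; z²/4)`. -/
noncomputable def omega (x : ℝ) (z s : ℂ) : ℂ :=
  (x : ℂ) ^ (1 / 2 - s) * Complex.exp (-z ^ 2 / 8) * kummer (1 - s / 2) (3 / 2) (z ^ 2 / 4)

/-- `Δ(x, z, s) = ω(x, z, s) + ω(x, z, 1 - s)`. -/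
noncomputable def Delta (x : ℝ) (z s : ℂ) : ℂ := omega x z s + omega x z (1 - s)

/-- `ρ(x, z, s) = x^{1/2 - s} e^{-z²/8} ₁F₁((1 - s)/2; 1/2; z²/4)`. -/
noncomputable def rho (x : ℝ) (z s : ℂ) : ℂ :=
  (x : ℂ) ^ (1 / 2 - s) * Complex.exp (-z ^ 2 / 8) * kummer ((1 - s) / 2) (1 / 2) (z ^ 2 / 4)

/-- `∇(x, z, s) = ρ(x, z, s) + ρ(x, z, 1 - s)`. -/
noncomputable def Nabla (x : ℝ) (z s : ℂ) : ℂ := rho x z s + rho x z (1 - s)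

open scoped Classical in
/-- The parity `a` of a character: `0` if `χ(-1) = 1`, and `1` otherwise. -/
noncomputable def parity {q : ℕ} (χ : DirichletCharacter ℂ q) : ℂ := if χ.Even then 0 else 1

/-- `ξ(s, χ) = (π/q)^{-(s + a)/2} Γ((s + a)/2) L(s, χ)`. -/
noncomputable def xi {q : ℕ} [NeZero q] (χ : DirichletCharacter ℂ q) (s : ℂ) : ℂ :=
  ((Real.pi / q : ℝ) : ℂ) ^ (-(s + parity χ) / 2) * Complex.Gamma ((s + parity χ) / 2) *
    DirichletCharacter.LFunction χ s

/-- `Ξ(t, χ) = ξ(1/2 + i t, χ)`. -/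
noncomputable def Xi {q : ℕ} [NeZero q] (χ : DirichletCharacter ℂ q) (t : ℂ) : ℂ :=
  xi χ (1 / 2 + Complex.I * t)

/-- The weight `(∑_{r=1}^{q-1} χ(r) e^{-2πrx/q}) / (1 - e^{-2πx})`. -/
noncomputable def weight {q : ℕ} (χ : DirichletCharacter ℂ q) (x : ℝ) : ℂ :=
  (∑ r ∈ Finset.Icc 1 (q - 1), χ (r : ZMod q) * (Real.exp (-(2 * Real.pi * r * x) / q) : ℂ)) /
    ((1 - Real.exp (-(2 * Real.pi * x)) : ℝ) : ℂ)

/-- `e^{-πα²x²/q} g(√π α x z / √q)` times the weight; `g` will be `sin`, `sinh`, `cos`, `cosh`. -/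
noncomputable def gaussIntegrand {q : ℕ} (χ : DirichletCharacter ℂ q) (g : ℂ → ℂ) (α : ℝ) (z : ℂ)
    (x : ℝ) : ℂ :=
  (Real.exp (-(Real.pi * α ^ 2 * x ^ 2) / q) : ℂ) *
    g (((Real.sqrt Real.pi * α * x : ℝ) : ℂ) * z / ((Real.sqrt q : ℝ) : ℂ)) * weight χ x

/-- `Γ((3 + it)/4) Γ((3 - it)/4) Ξ(t/2, χ) Δ(α, z, (1 + it)/2)`. -/
noncomputable def evenXiIntegrand {q : ℕ} [NeZero q] (χ : DirichletCharacter ℂ q) (α : ℝ) (z : ℂ)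
    (t : ℝ) : ℂ :=
  Complex.Gamma ((3 + Complex.I * t) / 4) * Complex.Gamma ((3 - Complex.I * t) / 4) *
    Xi χ (t / 2) * Delta α z ((1 + Complex.I * t) / 2)

/-- `Γ((1 + it)/4) Γ((1 - it)/4) Ξ(t/2, χ) ∇(α, z, (1 + it)/2)`. -/
noncomputable def oddXiIntegrand {q : ℕ} [NeZero q] (χ : DirichletCharacter ℂ q) (α : ℝ) (z : ℂ)
    (t : ℝ) : ℂ :=
  Complex.Gamma ((1 + Complex.I * t) / 4) * Complex.Gamma ((1 - Complex.I * t) / 4) *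
    Xi χ (t / 2) * Nabla α z ((1 + Complex.I * t) / 2)

end CharXi

/-!
All the integrals are instances of Parseval's formula for the Mellin transform on the critical line.
The weight is the sum `∑ χ(n) e^{-2π n x / q}`, so its Mellin transform is
`Γ(s) (2π / q)^{-s} L(s, χ)` (`mellin_weight`; the formula is continued from `Re s > 1` to
`Re s > 0`, which is possible since the weight stays bounded at `0` for nontrivial `χ`). Termwise
integration gives the Mellin transform of `e^{-x²} sinh(x z)` or `e^{-x²} cosh(x z)` as a product of
a gamma function and a Kummer function (`mellin_gaussMul`). After the duplication formula for
`Γ(s)`, Parseval's formula (`integral_gaussMul_mul_weight`) writes the `sinh` and `cosh` sides as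
integrals of `ξ(s, χ)` times `ω` or `ρ` over the whole critical line. Folding the line to a
half-line by the functional equation `ξ(1 - s, χ) = ξ(s, χ)` produces `Δ` and `∇`
(`integral_sinh_eq`, `integral_cosh_eq`).

The `sin` and `cos` sides need no second computation: `Δ` and `∇` are invariant under
`(α, z) ↦ (β, iz)` by Kummer's transformation (`kummer_eq_exp_mul_kummer`, `Delta_symm`,
`Nabla_symm`), and `sinh(iw) = i sin w`, `cosh(iw) = cos w`.

The functional equation in this form says that the root number of a primitive quadratic character is
`1` (`rootNumber_eq_one`), which is Gauss's determination of the sign of the quadratic Gauss sum.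
For an odd prime modulus, the sum `∑ e^{2πi r²/p}` is evaluated by comparing the two sides of the theta
transformation formula near a cusp (`sum_exp_sq_div`). The general modulus follows by the Chinese
remainder theorem, under which Gauss sums are multiplicative up to cross values that quadratic
reciprocity evaluates (`gaussSum_eq_crt`, `eq_jacobiSym_and_hasStandardGaussSum`); the prime power
factors of the modulus are odd primes, `4` and `8`.
-/

open Filter Topology

/-! ### Gaussian sums of periodic sequences -/

/-- Averaging principle for Gaussian sums: as `ε → 0` with `Re (1 / ε) → ∞`, the sum
`∑ₙ c(n) e^{-π ε n²}` of a periodic sequence `c` is asymptotic to `ε^{-1/2}` times the mean of `c`.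
The parameter may approach `0` along a non-real path. -/
theorem tendsto_sqrt_mul_tsum_gaussian {ι : Type*} {l : Filter ι} {ε : ι → ℂ}
    (hre : ∀ᶠ i in l, 0 < (ε i).re) (hinv : Tendsto (fun i => ((ε i)⁻¹).re) l atTop)
    (N : ℕ) [NeZero N] (c : ℤ → ℂ) (hc : ∀ m r : ℤ, c (m * N + r) = c r) :
    Tendsto (fun i => (ε i) ^ (1 / 2 : ℂ) * ∑' n : ℤ,
      c n * Complex.exp (-Real.pi * ε i * (n : ℂ) ^ 2)) l (𝓝 ((∑ r : Fin N, c (r : ℕ)) / N)) := by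
  have hN : (N : ℂ) ≠ 0 := Nat.cast_ne_zero.2 (NeZero.ne N)
  have hNr : (0 : ℝ) < N := Nat.cast_pos.2 (Nat.pos_of_ne_zero (NeZero.ne N))
  have hsum : ∀ a : ℂ, 0 < a.re →
      Summable fun n : ℤ => Complex.exp (-Real.pi * a * (n : ℂ) ^ 2) := by
    intro a ha
    have := (summable_jacobiTheta₂_term_iff 0 (Complex.I * a)).2 (by simpa using ha)
    refine this.congr fun n => ?_
    rw [jacobiTheta₂_term]
    congr 1
    linear_combination ((Real.pi : ℂ) * a * (n : ℂ) ^ 2) * Complex.I_sq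
  -- each residue class, after Poisson summation
  have key : ∀ᶠ i in l, (ε i) ^ (1 / 2 : ℂ) *
      ∑' n : ℤ, c n * Complex.exp (-Real.pi * ε i * (n : ℂ) ^ 2) =
      ∑ r : Fin N, c (r : ℕ) / N * ∑' n : ℤ, Complex.exp (-Real.pi * (ε i)⁻¹ * (n : ℂ) ^ 2 / N ^ 2 +
        2 * Real.pi * Complex.I * n * (r : ℕ) / N) := by
    filter_upwards [hre] with i hi
    set e := ε i
    have he : e ≠ 0 := by rintro h; simp [h] at hi
    have hs : Summable fun n : ℤ => c n * Complex.exp (-Real.pi * e * (n : ℂ) ^ 2) := by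
      refine Summable.of_norm_bounded (g := fun n : ℤ => (∑ r : Fin N, ‖c (r : ℕ)‖) *
        ‖Complex.exp (-Real.pi * e * (n : ℂ) ^ 2)‖) ((hsum e hi).norm.mul_left _) fun n => ?_
      rw [norm_mul]
      gcongr
      have h1 := (Int.divModEquiv N).symm_apply_apply n
      have h2 : c n = c (((Int.divModEquiv N) n).2 : ℕ) := by
        conv_lhs => rw [← h1]
        exact hc _ _
      rw [h2]
      exact Finset.single_le_sum (f := fun r : Fin N => ‖c (r : ℕ)‖) (fun _ _ => norm_nonneg _)
        (Finset.mem_univ _)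
    rw [← (Int.divModEquiv N).symm.tsum_eq]
    have hs' := ((Int.divModEquiv N).symm.summable_iff).2 hs
    rw [← (Equiv.prodComm (Fin N) ℤ).tsum_eq]
    have hs'' := ((Equiv.prodComm (Fin N) ℤ).summable_iff).2 hs'
    have := hs''.tsum_prod
    simp only [Function.comp_def] at this
    rw [this, tsum_fintype, Finset.mul_sum]
    refine Finset.sum_congr rfl fun r _ => ?_
    have hp := Complex.tsum_exp_neg_quadratic (a := ((N ^ 2 : ℝ) : ℂ) * e)
      (by rw [Complex.re_ofReal_mul]; positivity) (-(e * N * (r : ℕ)))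
    have h3 : ∀ m : ℤ, c ((Int.divModEquiv N).symm ((Equiv.prodComm (Fin N) ℤ) (r, m))) *
        Complex.exp (-Real.pi * e *
          (((Int.divModEquiv N).symm ((Equiv.prodComm (Fin N) ℤ) (r, m)) : ℤ) : ℂ) ^ 2) =
        c (r : ℕ) * Complex.exp (-Real.pi * e * (r : ℕ) ^ 2) *
        Complex.exp (-Real.pi * (((N ^ 2 : ℝ) : ℂ) * e) * m ^ 2 +
          2 * Real.pi * (-(e * N * (r : ℕ))) * m) := by
      intro m
      have h4 : (Int.divModEquiv N).symm ((Equiv.prodComm (Fin N) ℤ) (r, m)) = m * N + (r : ℕ) :=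
        rfl
      rw [h4, hc, mul_assoc (c _), ← Complex.exp_add]
      congr 2
      push_cast
      ring
    simp_rw [h3]
    rw [tsum_mul_left, hp]
    have hroot : (((N ^ 2 : ℝ) : ℂ) * e) ^ (1 / 2 : ℂ) = N * e ^ (1 / 2 : ℂ) := by
      rw [Complex.cpow_def_of_ne_zero (mul_ne_zero (by simp [NeZero.ne N]) he),
        Complex.log_ofReal_mul (by positivity) he, add_mul, Complex.exp_add,
        ← Complex.cpow_def_of_ne_zero he, Real.log_pow]
      congr 1
      rw [show (((2 : ℕ) * Real.log N : ℝ) : ℂ) * (1 / 2) = (Real.log N : ℂ) by push_cast; ring,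
        ← Complex.ofReal_exp, Real.exp_log hNr, Complex.ofReal_natCast]
    have hse : e ^ (1 / 2 : ℂ) ≠ 0 := by rw [Ne, Complex.cpow_eq_zero_iff]; tauto
    rw [hroot]
    have h5 : ∀ n : ℤ, Complex.exp (-Real.pi * e * (r : ℕ) ^ 2) *
        Complex.exp (-Real.pi / (((N ^ 2 : ℝ) : ℂ) * e) *
          (n + Complex.I * (-(e * N * (r : ℕ)))) ^ 2) =
        Complex.exp (-Real.pi * e⁻¹ * (n : ℂ) ^ 2 / N ^ 2 +
          2 * Real.pi * Complex.I * n * (r : ℕ) / N) := by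
      intro n
      rw [← Complex.exp_add]
      congr 1
      push_cast
      field_simp
      linear_combination (-(e ^ 2 * (N : ℂ) ^ 2 * (r : ℕ) ^ 2)) * Complex.I_sq
    simp_rw [← h5]
    rw [tsum_mul_left]
    field_simp
  have lim : ∀ r : Fin N, Tendsto (fun i => ∑' n : ℤ,
      Complex.exp (-Real.pi * (ε i)⁻¹ * (n : ℂ) ^ 2 / N ^ 2 +
        2 * Real.pi * Complex.I * n * (r : ℕ) / N)) l (𝓝 1) := by
    intro r
    have hnorm : ∀ i, ∀ n : ℤ, ‖Complex.exp (-Real.pi * (ε i)⁻¹ * (n : ℂ) ^ 2 / N ^ 2 +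
        2 * Real.pi * Complex.I * n * (r : ℕ) / N)‖ =
        Real.exp (-((Real.pi * n ^ 2 / N ^ 2) * ((ε i)⁻¹).re)) := by
      intro i n
      rw [Complex.norm_exp]
      congr 1
      have h1 : -Real.pi * (ε i)⁻¹ * (n : ℂ) ^ 2 / N ^ 2 +
        2 * Real.pi * Complex.I * n * (r : ℕ) / N =
        ((-(Real.pi * n ^ 2 / N ^ 2) : ℝ) : ℂ) * (ε i)⁻¹ +
        ((2 * Real.pi * n * (r : ℕ) / N : ℝ) : ℂ) * Complex.I := by
        push_cast; ring
      rw [h1, Complex.add_re, Complex.re_ofReal_mul, Complex.re_ofReal_mul, Complex.I_re]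
      ring
    have hone : (1 : ℂ) = ∑' n : ℤ, if n = 0 then 1 else 0 := by rw [tsum_ite_eq]
    rw [hone]
    refine tendsto_tsum_of_dominated_convergence
      (bound := fun n : ℤ => ‖Complex.exp (-Real.pi * (1 : ℂ) * (n : ℂ) ^ 2)‖)
      (hsum 1 (by simp)).norm ?_ ?_
    · intro n
      split_ifs with hn
      · subst hn; simpa using tendsto_const_nhds
      · rw [tendsto_zero_iff_norm_tendsto_zero]
        simp_rw [hnorm]
        refine Real.tendsto_exp_atBot.comp (tendsto_neg_atTop_atBot.comp ?_)
        refine Tendsto.const_mul_atTop ?_ hinv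
        have : (0 : ℝ) < (n : ℝ) ^ 2 := by positivity
        have := Real.pi_pos
        positivity
    · filter_upwards [hinv.eventually_ge_atTop ((N : ℝ) ^ 2)] with i hi n
      rw [hnorm, Complex.norm_exp]
      refine Real.exp_le_exp.2 ?_
      have h1 : (-Real.pi * (1 : ℂ) * (n : ℂ) ^ 2).re = -(Real.pi * n ^ 2) := by
        have : -Real.pi * (1 : ℂ) * (n : ℂ) ^ 2 = ((-(Real.pi * n ^ 2) : ℝ) : ℂ) := by
          push_cast; ring
        rw [this, Complex.ofReal_re]
      rw [h1, neg_le_neg_iff]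
      calc Real.pi * n ^ 2 = Real.pi * n ^ 2 / N ^ 2 * (N : ℝ) ^ 2 := by field_simp
        _ ≤ _ := by have := Real.pi_pos; gcongr
  have := tendsto_finsetSum Finset.univ fun r _ => (lim r).const_mul (c ((r : Fin N) : ℕ) / N)
  refine (this.congr' (key.mono fun i hi => hi.symm)).trans (le_of_eq ?_)
  simp [Finset.sum_div]

/-! ### The quadratic Gauss sum -/

/-- The quadratic Gauss sum. As `t → 0+`, the theta series `∑ₙ e^{-π (t - 2i/p) n²}` and its Poisson
transform `∑ₙ e^{-π n² / (t - 2i/p)}` are both governed by averages of periodic sequences: of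
`e^{2πi n²/p}` on one side, and of `e^{-πi p n²/2}`, which has period `2`, on the other. Comparing
the leading terms evaluates the Gauss sum. -/
theorem sum_exp_sq_div (p : ℕ) [NeZero p] :
    ∑ r : Fin p, Complex.exp (2 * Real.pi * Complex.I * ((r : ℕ) : ℂ) ^ 2 / p) =
      (Real.sqrt p : ℂ) * (1 + (-Complex.I) ^ p) / (1 - Complex.I) := by
  have hp : (p : ℂ) ≠ 0 := Nat.cast_ne_zero.2 (NeZero.ne p)
  have hpr : (0 : ℝ) < p := Nat.cast_pos.2 (Nat.pos_of_ne_zero (NeZero.ne p))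
  set l : Filter ℝ := 𝓝[>] 0
  have hl : ∀ᶠ t : ℝ in l, 0 < t := self_mem_nhdsWithin
  have hl0 : Tendsto (fun t : ℝ => (t : ℂ)) l (𝓝 0) :=
    (Complex.continuous_ofReal.tendsto' 0 0 (by simp)).mono_left nhdsWithin_le_nhds
  -- near the cusp `2 / p`
  have T1 := tendsto_sqrt_mul_tsum_gaussian (l := l) (ε := fun t : ℝ => (t : ℂ))
    (by simpa using hl) (by
      have : (fun t : ℝ => (((t : ℂ))⁻¹).re) = fun t => t⁻¹ := by
        ext t; rw [← Complex.ofReal_inv, Complex.ofReal_re]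
      rw [this]; exact tendsto_inv_nhdsGT_zero) p
    (fun n => Complex.exp (2 * Real.pi * Complex.I * (n : ℂ) ^ 2 / p)) (by
      intro m r
      rw [show 2 * Real.pi * Complex.I * ((m * p + r : ℤ) : ℂ) ^ 2 / p =
        2 * Real.pi * Complex.I * (r : ℂ) ^ 2 / p +
          ((m ^ 2 * p + 2 * m * r : ℤ) : ℂ) * (2 * Real.pi * Complex.I) by
          push_cast; field_simp; ring, Complex.exp_periodic.int_mul])
  -- near the cusp `-p / 2`, the image of `2 / p`
  -- `u` is chosen so that `1 / (t - 2i/p) = ip/2 + t u(t)`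
  set u : ℝ → ℂ := fun t => (p : ℂ) ^ 2 / (4 + 2 * Complex.I * p * t) with hu
  have hden : ∀ t : ℝ, (4 + 2 * Complex.I * p * t : ℂ) ≠ 0 := by
    intro t h
    have := congrArg Complex.re h
    simp at this
  have huinv : ∀ t : ℝ, 0 < t → (((t : ℂ) * u t)⁻¹).re = 4 / p ^ 2 * t⁻¹ := by
    intro t ht
    have : ((t : ℂ) * u t)⁻¹ = ((4 / p ^ 2 * t⁻¹ : ℝ) : ℂ) + ((2 / p : ℝ) : ℂ) * Complex.I := by
      have h1 : (t : ℂ) ≠ 0 := Complex.ofReal_ne_zero.2 ht.ne'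
      simp only [hu]
      have := hden t
      push_cast
      field_simp
    rw [this, Complex.add_re, Complex.ofReal_re, Complex.re_ofReal_mul]
    simp
  have hure : ∀ t : ℝ, 0 < t → 0 < ((t : ℂ) * u t).re := by
    intro t ht
    have h1 : 0 < (((t : ℂ) * u t)⁻¹).re := by rw [huinv t ht]; positivity
    rw [Complex.inv_re] at h1
    by_contra! h
    exact absurd h1 (not_lt.2 (div_nonpos_of_nonpos_of_nonneg h (Complex.normSq_nonneg _)))
  have T2 := tendsto_sqrt_mul_tsum_gaussian (l := l) (ε := fun t : ℝ => (t : ℂ) * u t)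
    (hl.mono hure) (by
      refine Tendsto.congr' (hl.mono fun t ht => (huinv t ht).symm) ?_
      exact Tendsto.const_mul_atTop (by positivity) tendsto_inv_nhdsGT_zero) 2
    (fun n => Complex.exp (-(Real.pi * Complex.I * p * (n : ℂ) ^ 2 / 2))) (by
      intro m r
      rw [show -(Real.pi * Complex.I * p * ((m * (2 : ℕ) + r : ℤ) : ℂ) ^ 2 / 2) =
        -(Real.pi * Complex.I * p * (r : ℂ) ^ 2 / 2) +
          ((-(p * (m ^ 2 + m * r)) : ℤ) : ℂ) * (2 * Real.pi * Complex.I) by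
          push_cast; ring, Complex.exp_periodic.int_mul])
  have hul : Tendsto (fun t => (u t ^ (1 / 2 : ℂ))⁻¹) l (𝓝 (2 / p)) := by
    have h1 : Tendsto u l (𝓝 ((p / 2 : ℂ) ^ 2)) := by
      have : Tendsto (fun t : ℝ => (p : ℂ) ^ 2 / (4 + 2 * Complex.I * p * t)) l
          (𝓝 ((p : ℂ) ^ 2 / (4 + 2 * Complex.I * p * 0))) :=
        tendsto_const_nhds.div (tendsto_const_nhds.add (hl0.const_mul _)) (by simp)
      convert this using 2
      field_simp
      ring
    have hre : 0 < (p / 2 : ℂ).re := by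
      rw [show (p / 2 : ℂ) = ((p / 2 : ℝ) : ℂ) by push_cast; ring, Complex.ofReal_re]; positivity
    have h2 : ((p / 2 : ℂ) ^ 2) ^ (1 / 2 : ℂ) = p / 2 := by
      rw [one_div, Complex.sq_cpow_two_inv hre]
    have h3 : ((p / 2 : ℂ) ^ 2) ∈ Complex.slitPlane := by
      rw [show (p / 2 : ℂ) ^ 2 = (((p / 2) ^ 2 : ℝ) : ℂ) by push_cast; ring,
        Complex.ofReal_mem_slitPlane]
      positivity
    have h4 := (h1.cpow tendsto_const_nhds h3 : Tendsto (fun t => u t ^ (1 / 2 : ℂ)) l _)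
    rw [h2] at h4
    have := h4.inv₀ (by simpa using hp)
    rwa [inv_div] at this
  have hal : Tendsto (fun t : ℝ => (((t : ℂ) - 2 * Complex.I / p) ^ (1 / 2 : ℂ))⁻¹) l
      (𝓝 ((Real.sqrt p : ℂ) / (1 - Complex.I))) := by
    have hsq : ((Real.sqrt p : ℝ) : ℂ) ^ 2 = p := by
      rw [← Complex.ofReal_pow, Real.sq_sqrt hpr.le, Complex.ofReal_natCast]
    have hs0 : ((Real.sqrt p : ℝ) : ℂ) ≠ 0 := by
      intro h; rw [h] at hsq; exact hp (by rw [← hsq]; simp)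
    have h0 : ((1 - Complex.I) / (Real.sqrt p : ℂ)) ^ 2 = 0 - 2 * Complex.I / p := by
      rw [div_pow, hsq]
      field_simp
      linear_combination Complex.I_sq
    have h1 : Tendsto (fun t : ℝ => (t : ℂ) - 2 * Complex.I / p) l
        (𝓝 (((1 - Complex.I) / (Real.sqrt p : ℂ)) ^ 2)) := by
      rw [h0]; exact hl0.sub tendsto_const_nhds
    have hre : 0 < ((1 - Complex.I) / (Real.sqrt p : ℂ)).re := by
      rw [Complex.div_ofReal_re]; simp only [Complex.sub_re, Complex.one_re, Complex.I_re, sub_zero]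
      positivity
    have h3 : ((1 - Complex.I) / (Real.sqrt p : ℂ)) ^ 2 ∈ Complex.slitPlane := by
      rw [h0, Complex.mem_slitPlane_iff]
      right
      rw [show 0 - 2 * Complex.I / (p : ℂ) = ((-(2 / p) : ℝ) : ℂ) * Complex.I by push_cast; ring,
        Complex.im_ofReal_mul, Complex.I_im]
      have : (0 : ℝ) < 2 / p := by positivity
      linarith
    have h4 := (h1.cpow tendsto_const_nhds h3 : Tendsto (fun t : ℝ =>
      ((t : ℂ) - 2 * Complex.I / p) ^ (1 / 2 : ℂ)) l _)
    rw [one_div, Complex.sq_cpow_two_inv hre, ← one_div] at h4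
    have := h4.inv₀ (fun h => by rw [h] at hre; simp at hre)
    rwa [inv_div] at this
  -- both limits compute the leading term of the same theta series
  have T3 := (hul.mul hal).mul T2
  have T4 := tendsto_nhds_unique T1 (T3.congr' (by
    filter_upwards [hl] with t ht
    have ht0 : (t : ℂ) ≠ 0 := Complex.ofReal_ne_zero.2 ht.ne'
    have hu0 : u t ≠ 0 := div_ne_zero (pow_ne_zero _ hp) (hden t)
    have hroot : ((t : ℂ) * u t) ^ (1 / 2 : ℂ) = (t : ℂ) ^ (1 / 2 : ℂ) * u t ^ (1 / 2 : ℂ) := by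
      rw [Complex.cpow_def_of_ne_zero (mul_ne_zero ht0 hu0), Complex.log_ofReal_mul ht hu0, add_mul,
        Complex.exp_add, ← Complex.cpow_def_of_ne_zero hu0, Complex.ofReal_log ht.le,
        ← Complex.cpow_def_of_ne_zero ht0]
    have ha : 0 < ((t : ℂ) - 2 * Complex.I / p).re := by
      rw [show (t : ℂ) - 2 * Complex.I / (p : ℂ) = (t : ℂ) - ((2 / p : ℝ) : ℂ) * Complex.I by
        push_cast; ring]
      simpa using ht
    have ha0 : (t : ℂ) - 2 * Complex.I / p ≠ 0 := by intro h; rw [h] at ha; simp at ha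
    have hpois := Complex.tsum_exp_neg_mul_int_sq ha
    have e1 : ∀ n : ℤ, Complex.exp (2 * Real.pi * Complex.I * (n : ℂ) ^ 2 / p) *
        Complex.exp (-Real.pi * t * (n : ℂ) ^ 2) =
        Complex.exp (-Real.pi * ((t : ℂ) - 2 * Complex.I / p) * (n : ℂ) ^ 2) := by
      intro n
      rw [← Complex.exp_add]; congr 1; ring
    have e2 : ∀ n : ℤ, Complex.exp (-(Real.pi * Complex.I * p * (n : ℂ) ^ 2 / 2)) *
        Complex.exp (-Real.pi * (t * u t) * (n : ℂ) ^ 2) =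
        Complex.exp (-Real.pi / ((t : ℂ) - 2 * Complex.I / p) * (n : ℂ) ^ 2) := by
      intro n
      rw [← Complex.exp_add]; congr 1
      have : 1 / ((t : ℂ) - 2 * Complex.I / p) = Complex.I * p / 2 + t * u t := by
        rw [div_eq_iff ha0]
        simp only [hu]
        have : (2 + Complex.I * p * t : ℂ) ≠ 0 := fun h => hden t (by linear_combination 2 * h)
        rw [show (4 + 2 * Complex.I * p * t : ℂ) = 2 * (2 + Complex.I * p * t) by ring]
        field_simp
        ring_nf
        linear_combination (4 + 2 * Complex.I * p * t - p ^ 2 * t ^ 2) * Complex.I_sq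
      rw [div_eq_mul_one_div (-Real.pi : ℂ) ((t : ℂ) - 2 * Complex.I / p), this]
      ring
    simp_rw [e1, e2]
    rw [hpois, hroot]
    have h1 : u t ^ (1 / 2 : ℂ) ≠ 0 := by rw [Ne, Complex.cpow_eq_zero_iff]; tauto
    field_simp))
  have hexp : Complex.exp (-(Real.pi * Complex.I * p / 2)) = (-Complex.I) ^ p := by
    rw [show -(Real.pi * Complex.I * p / 2) = (p : ℂ) * (-(Real.pi / 2 * Complex.I)) by ring,
      Complex.exp_nat_mul, Complex.exp_neg, Complex.exp_pi_div_two_mul_I, Complex.inv_I]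
  rw [Fin.sum_univ_two] at T4
  simp only [Int.cast_natCast, Fin.val_zero, Fin.val_one, Nat.cast_zero, Nat.cast_one] at T4
  norm_num at T4
  rw [hexp] at T4
  field_simp at T4 ⊢
  linear_combination T4

/-! ### Characters and Gauss sums modulo a product of coprime moduli -/

namespace DirichletCharacter

lemma factorsThrough_iff_castHom {n d : ℕ} [NeZero n] (χ : DirichletCharacter ℂ n) (hd : d ∣ n) :
    χ.FactorsThrough d ↔ ∀ u : (ZMod n)ˣ, ZMod.castHom hd (ZMod d) u = 1 → χ u = 1 := by
  rw [factorsThrough_iff_ker_unitsMap hd]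
  constructor
  · intro h u hu
    have h1 : u ∈ (MulChar.toUnitHom χ).ker := h (by
      rw [MonoidHom.mem_ker]
      ext
      simpa [ZMod.unitsMap_def] using hu)
    rw [MonoidHom.mem_ker] at h1
    rw [← MulChar.coe_toUnitHom, h1, Units.val_one]
  · intro h u hu
    rw [MonoidHom.mem_ker] at hu ⊢
    ext
    rw [MulChar.coe_toUnitHom, Units.val_one]
    refine h u ?_
    simpa [ZMod.unitsMap_def] using congrArg Units.val hu

section CRT

variable {a b : ℕ} (h : a.Coprime b)

/-- The component modulo `a` of a character modulo `a * b`, where `a` and `b` are coprime. -/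
noncomputable def crtLeft (χ : DirichletCharacter ℂ (a * b)) : DirichletCharacter ℂ a where
  toFun x := χ ((ZMod.chineseRemainder h).symm (x, 1))
  map_one' := by rw [← Prod.one_eq_mk, map_one, map_one]
  map_mul' x y := by
    rw [← map_mul, ← map_mul, Prod.mk_mul_mk, one_mul]
  map_nonunit' x hx := by
    refine MulChar.map_nonunit _ fun hu => hx ?_
    have := hu.map (ZMod.chineseRemainder h)
    rw [RingEquiv.apply_symm_apply, Prod.isUnit_iff] at this
    exact this.1

/-- The component modulo `b` of a character modulo `a * b`, where `a` and `b` are coprime. -/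
noncomputable def crtRight (χ : DirichletCharacter ℂ (a * b)) : DirichletCharacter ℂ b where
  toFun x := χ ((ZMod.chineseRemainder h).symm (1, x))
  map_one' := by rw [← Prod.one_eq_mk, map_one, map_one]
  map_mul' x y := by
    rw [← map_mul, ← map_mul, Prod.mk_mul_mk, one_mul]
  map_nonunit' x hx := by
    refine MulChar.map_nonunit _ fun hu => hx ?_
    have := hu.map (ZMod.chineseRemainder h)
    rw [RingEquiv.apply_symm_apply, Prod.isUnit_iff] at this
    exact this.2

variable (χ : DirichletCharacter ℂ (a * b))

lemma crtLeft_apply (x : ZMod a) : crtLeft h χ x = χ ((ZMod.chineseRemainder h).symm (x, 1)) := rfl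

lemma crtRight_apply (x : ZMod b) : crtRight h χ x = χ ((ZMod.chineseRemainder h).symm (1, x)) :=
  rfl

lemma apply_symm_chineseRemainder (x : ZMod a) (y : ZMod b) :
    χ ((ZMod.chineseRemainder h).symm (x, y)) = crtLeft h χ x * crtRight h χ y := by
  rw [crtLeft_apply, crtRight_apply, ← map_mul, ← map_mul, Prod.mk_mul_mk, one_mul, mul_one]

lemma apply_intCast_eq_crt (n : ℤ) : χ n = crtLeft h χ n * crtRight h χ n := by
  rw [← apply_symm_chineseRemainder]
  congr 1
  rw [RingEquiv.eq_symm_apply, map_intCast]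
  rfl

lemma isQuadratic_crtLeft (hχ : χ.IsQuadratic) : (crtLeft h χ).IsQuadratic := fun _ => hχ _

lemma isQuadratic_crtRight (hχ : χ.IsQuadratic) : (crtRight h χ).IsQuadratic := fun _ => hχ _

variable [NeZero a] [NeZero b]

lemma factorsThrough_mul_of_crt {d e : ℕ} (hd : (crtLeft h χ).FactorsThrough d)
    (he : (crtRight h χ).FactorsThrough e) : χ.FactorsThrough (d * e) := by
  have hd' := hd.dvd
  have he' := he.dvd
  rw [factorsThrough_iff_castHom _ hd'] at hd
  rw [factorsThrough_iff_castHom _ he'] at he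
  rw [factorsThrough_iff_castHom _ (mul_dvd_mul hd' he')]
  intro u hu
  obtain ⟨n, hn⟩ := ZMod.intCast_surjective (u : ZMod (a * b))
  rw [← hn] at hu ⊢
  rw [apply_intCast_eq_crt h]
  have hcop : IsUnit (n : ZMod (a * b)) := hn ▸ u.isUnit
  rw [map_intCast] at hu
  have hua : IsUnit (n : ZMod a) := by
    simpa using hcop.map (ZMod.castHom (dvd_mul_right a b) (ZMod a))
  have hub : IsUnit (n : ZMod b) := by
    simpa using hcop.map (ZMod.castHom (dvd_mul_left b a) (ZMod b))
  have h1 := hd hua.unit (by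
    rw [IsUnit.unit_spec, map_intCast]
    simpa using congrArg (ZMod.castHom (dvd_mul_right d e) (ZMod d)) hu)
  have h2 := he hub.unit (by
    rw [IsUnit.unit_spec, map_intCast]
    simpa using congrArg (ZMod.castHom (dvd_mul_left e d) (ZMod e)) hu)
  rw [IsUnit.unit_spec] at h1 h2
  rw [h1, h2, one_mul]

lemma isPrimitive_crt (hχ : χ.IsPrimitive) :
    (crtLeft h χ).IsPrimitive ∧ (crtRight h χ).IsPrimitive := by
  have hf := factorsThrough_mul_of_crt h χ (factorsThrough_conductor _) (factorsThrough_conductor _)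
  have hle : a * b ≤ (crtLeft h χ).conductor * (crtRight h χ).conductor := by
    conv_lhs => rw [← (isPrimitive_def χ).1 hχ]
    exact Nat.sInf_le hf
  have ha := Nat.le_of_dvd (Nat.pos_of_ne_zero (NeZero.ne a)) (conductor_dvd_level (crtLeft h χ))
  have hb := Nat.le_of_dvd (Nat.pos_of_ne_zero (NeZero.ne b)) (conductor_dvd_level (crtRight h χ))
  have ha0 := Nat.pos_of_ne_zero (NeZero.ne a)
  have hb0 := Nat.pos_of_ne_zero (NeZero.ne b)
  simp only [isPrimitive_def]
  constructor
  · refine le_antisymm ha (Nat.le_of_mul_le_mul_right (hle.trans ?_) hb0)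
    exact Nat.mul_le_mul_left _ hb
  · refine le_antisymm hb (Nat.le_of_mul_le_mul_left (hle.trans ?_) ha0)
    exact Nat.mul_le_mul_right _ ha

/-- Gauss sums are multiplicative in the modulus, up to the cross values of the components. -/
theorem gaussSum_eq_crt :
    gaussSum χ ZMod.stdAddChar = crtLeft h χ b * crtRight h χ a *
      (gaussSum (crtLeft h χ) ZMod.stdAddChar * gaussSum (crtRight h χ) ZMod.stdAddChar) := by
  -- `(x, y) ↦ b x + a y` is used instead of the inverse of `ZMod.chineseRemainder`, because it
  -- splits the additive character
  set B : (ZMod a)ˣ := ZMod.unitOfCoprime b h.symm with hB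
  set A : (ZMod b)ˣ := ZMod.unitOfCoprime a h with hA
  let E : ZMod a × ZMod b ≃ ZMod (a * b) :=
    ((Units.mulLeft B).prodCongr (Units.mulLeft A)).trans (ZMod.chineseRemainder h).symm.toEquiv
  have hE : ∀ x y, E (x, y) = (ZMod.chineseRemainder h).symm (b * x, a * y) := fun x y => rfl
  have hadd : ∀ x y, ZMod.stdAddChar (E (x, y)) =
      (ZMod.stdAddChar x : ℂ) * ZMod.stdAddChar y := by
    intro x y
    obtain ⟨m, rfl⟩ := ZMod.intCast_surjective x
    obtain ⟨n, rfl⟩ := ZMod.intCast_surjective y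
    have : E (m, n) = ((b * m + a * n : ℤ) : ZMod (a * b)) := by
      rw [hE, RingEquiv.symm_apply_eq, map_intCast]
      ext <;> simp
    rw [this, ZMod.stdAddChar_coe, ZMod.stdAddChar_coe, ZMod.stdAddChar_coe, ← Complex.exp_add]
    have ha : (a : ℂ) ≠ 0 := Nat.cast_ne_zero.2 (NeZero.ne a)
    have hb : (b : ℂ) ≠ 0 := Nat.cast_ne_zero.2 (NeZero.ne b)
    congr 1
    push_cast
    field_simp
  simp only [gaussSum]
  rw [← E.sum_comp, Fintype.sum_prod_type, Finset.sum_mul_sum, Finset.mul_sum]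
  refine Finset.sum_congr rfl fun x _ => ?_
  rw [Finset.mul_sum]
  refine Finset.sum_congr rfl fun y _ => ?_
  rw [hadd, hE, apply_symm_chineseRemainder, map_mul, map_mul]
  ring

end CRT

/-- The Gauss sum of `χ` with respect to `e^{2πi x/N}` is `√N` for `χ` even and `i √N` for `χ`
odd. -/
def HasStandardGaussSum {N : ℕ} [NeZero N] (χ : DirichletCharacter ℂ N) : Prop :=
  (χ.Even → gaussSum χ ZMod.stdAddChar = (Real.sqrt N : ℂ)) ∧
    (χ.Odd → gaussSum χ ZMod.stdAddChar = Complex.I * (Real.sqrt N : ℂ))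

/-- Multiplicativity of the standard evaluation. The hypotheses on the cross values are quadratic
reciprocity for the two components. -/
lemma HasStandardGaussSum.of_crt {a b : ℕ} [NeZero a] [NeZero b] (h : a.Coprime b)
    (χ : DirichletCharacter ℂ (a * b)) (ha : HasStandardGaussSum (crtLeft h χ))
    (hb : HasStandardGaussSum (crtRight h χ))
    (h1 : (crtLeft h χ).Even ∨ (crtRight h χ).Even → crtLeft h χ b * crtRight h χ a = 1)
    (h2 : (crtLeft h χ).Odd → (crtRight h χ).Odd → crtLeft h χ b * crtRight h χ a = -1) :
    HasStandardGaussSum χ := by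
  have hneg : χ (-1) = crtLeft h χ (-1) * crtRight h χ (-1) := by
    simpa using apply_intCast_eq_crt h χ (-1)
  have hsq : (Real.sqrt (a * b : ℕ) : ℂ) = (Real.sqrt a : ℂ) * (Real.sqrt b : ℂ) := by
    rw [Nat.cast_mul, Real.sqrt_mul (Nat.cast_nonneg a), Complex.ofReal_mul]
  rcases (crtLeft h χ).even_or_odd with hl | hl <;> rcases (crtRight h χ).even_or_odd with hr | hr
  · have he : χ.Even := by rw [Even, hneg, hl, hr, one_mul]
    refine ⟨fun _ => ?_, fun ho => absurd ho he.not_odd⟩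
    rw [gaussSum_eq_crt h, h1 (.inl hl), ha.1 hl, hb.1 hr, hsq, one_mul]
  · have he : χ.Odd := by rw [Odd, hneg, hl, hr, one_mul]
    refine ⟨fun ho => absurd ho he.not_even, fun _ => ?_⟩
    rw [gaussSum_eq_crt h, h1 (.inl hl), ha.1 hl, hb.2 hr, hsq]; ring
  · have he : χ.Odd := by rw [Odd, hneg, hl, hr, mul_one]
    refine ⟨fun ho => absurd ho he.not_even, fun _ => ?_⟩
    rw [gaussSum_eq_crt h, h1 (.inr hr), ha.2 hl, hb.1 hr, hsq]; ring
  · have he : χ.Even := by rw [Even, hneg, hl, hr]; norm_num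
    refine ⟨fun _ => ?_, fun ho => absurd ho he.not_odd⟩
    rw [gaussSum_eq_crt h, h2 hl hr, ha.2 hl, hb.2 hr, hsq]
    linear_combination (-(Real.sqrt a : ℂ) * (Real.sqrt b : ℂ)) * Complex.I_sq

/-! ### Quadratic characters modulo prime powers -/

lemma bijective_natCast_fin (n : ℕ) [NeZero n] :
    Function.Bijective fun r : Fin n => ((r : ℕ) : ZMod n) := by
  refine (Fintype.bijective_iff_injective_and_card _).2 ⟨fun r s hrs => ?_, by simp⟩
  have := congrArg ZMod.val hrs
  simp only [ZMod.val_cast_of_lt r.2, ZMod.val_cast_of_lt s.2] at this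
  exact Fin.ext this

lemma apply_unit_of_isQuadratic {n : ℕ} {χ : DirichletCharacter ℂ n} (hχ : χ.IsQuadratic)
    {x : ZMod n} (hx : IsUnit x) : χ x = 1 ∨ χ x = -1 :=
  (hχ x).resolve_left (hx.map χ).ne_zero

lemma not_isPrimitive_of_factorsThrough {n d : ℕ} {χ : DirichletCharacter ℂ n} (hd : d < n)
    (h : χ.FactorsThrough d) : ¬ χ.IsPrimitive := fun hp => by
  have h1 : χ.conductor ≤ d := Nat.sInf_le h
  rw [(isPrimitive_def χ).1 hp] at h1
  omega

/-- A quadratic character modulo `p ^ n` with `p` odd and `n ≥ 2` is not primitive: the kernel of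
reduction modulo `p ^ (n - 1)` has odd exponent `p`. -/
lemma not_isPrimitive_prime_pow {p n : ℕ} (hp : p.Prime) (hodd : _root_.Odd p) (hn : 2 ≤ n)
    {χ : DirichletCharacter ℂ (p ^ n)} (hχ : χ.IsQuadratic) : ¬ χ.IsPrimitive := by
  have : NeZero (p ^ n) := ⟨pow_ne_zero _ hp.ne_zero⟩
  have hdvd : p ^ (n - 1) ∣ p ^ n := pow_dvd_pow _ (Nat.sub_le _ _)
  refine not_isPrimitive_of_factorsThrough (d := p ^ (n - 1))
    (Nat.pow_lt_pow_right hp.one_lt (by omega)) ?_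
  rw [factorsThrough_iff_castHom _ hdvd]
  intro u hu
  obtain ⟨m, hm⟩ := ZMod.intCast_surjective (u : ZMod (p ^ n))
  have hu' : ((m - 1 : ℤ) : ZMod (p ^ (n - 1))) = 0 := by
    rw [← hm, map_intCast] at hu
    push_cast
    rw [hu, sub_self]
  rw [ZMod.intCast_zmod_eq_zero_iff_dvd] at hu'
  obtain ⟨t, ht⟩ := hu'
  obtain ⟨k, hk⟩ := Polynomial.powAddExpansion (1 : ℤ) ((p ^ (n - 1) : ℕ) * t) p
  have hpow : (u : ZMod (p ^ n)) ^ p = 1 := by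
    have h1 : m ^ p - 1 = (p ^ n : ℕ) * (t + k * p ^ (n - 2) * t ^ 2) := by
      rw [show m = 1 + (p ^ (n - 1) : ℕ) * t by linarith, hk]
      obtain ⟨j, rfl⟩ := Nat.exists_eq_add_of_le hn
      simp only [one_pow, Nat.add_sub_cancel_left, show 2 + j - 1 = j + 1 by omega]
      push_cast
      ring
    have h2 : ((m ^ p - 1 : ℤ) : ZMod (p ^ n)) = 0 :=
      (ZMod.intCast_zmod_eq_zero_iff_dvd _ _).2 ⟨_, h1⟩
    push_cast at h2
    rw [← hm]
    exact sub_eq_zero.1 h2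
  rcases apply_unit_of_isQuadratic hχ u.isUnit with h | h
  · exact h
  · have := congrArg χ hpow
    rw [map_pow, h, hodd.neg_one_pow, map_one] at this
    norm_num at this

/-- A quadratic character modulo `2 ^ n` with `n ≥ 4` is not primitive: every residue that is `1`
modulo `2 ^ (n - 1)` is a square. -/
lemma not_isPrimitive_two_pow {n : ℕ} (hn : 4 ≤ n) {χ : DirichletCharacter ℂ (2 ^ n)}
    (hχ : χ.IsQuadratic) : ¬ χ.IsPrimitive := by
  have hdvd : 2 ^ (n - 1) ∣ 2 ^ n := pow_dvd_pow _ (Nat.sub_le _ _)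
  refine not_isPrimitive_of_factorsThrough (d := 2 ^ (n - 1))
    (Nat.pow_lt_pow_right one_lt_two (by omega)) ?_
  rw [factorsThrough_iff_castHom _ hdvd]
  intro u hu
  obtain ⟨m, hm⟩ := ZMod.intCast_surjective (u : ZMod (2 ^ n))
  have hu' : ((m - 1 : ℤ) : ZMod (2 ^ (n - 1))) = 0 := by
    rw [← hm, map_intCast] at hu
    push_cast
    rw [hu, sub_self]
  rw [ZMod.intCast_zmod_eq_zero_iff_dvd] at hu'
  obtain ⟨t, ht⟩ := hu'
  have hsq : (u : ZMod (2 ^ n)) = ((1 + 2 ^ (n - 2) * t : ℤ) : ZMod (2 ^ n)) ^ 2 := by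
    have h1 : m - (1 + 2 ^ (n - 2) * t) ^ 2 = (2 ^ n : ℕ) * (- 2 ^ (n - 4) * t ^ 2) := by
      rw [show m = 1 + (2 ^ (n - 1) : ℕ) * t by linarith]
      obtain ⟨j, rfl⟩ := Nat.exists_eq_add_of_le hn
      simp only [show 4 + j - 1 = j + 3 by omega, show 4 + j - 2 = j + 2 by omega,
        show 4 + j - 4 = j by omega]
      push_cast
      ring
    have h2 : ((m - (1 + 2 ^ (n - 2) * t) ^ 2 : ℤ) : ZMod (2 ^ n)) = 0 :=
      (ZMod.intCast_zmod_eq_zero_iff_dvd _ _).2 ⟨_, h1⟩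
    rw [Int.cast_sub, Int.cast_pow] at h2
    rw [← hm]
    exact sub_eq_zero.1 h2
  have hunit : IsUnit (((1 + 2 ^ (n - 2) * t : ℤ) : ZMod (2 ^ n))) := by
    have := u.isUnit
    rw [hsq] at this
    exact isUnit_of_mul_isUnit_left (by rwa [← sq])
  rw [hsq, map_pow]
  rcases apply_unit_of_isQuadratic hχ hunit with h | h <;> rw [h] <;> norm_num

/-- There is only one nontrivial quadratic character modulo a prime: it is `1` on squares, hence
`-1` on all nonsquares as soon as it is `-1` somewhere. -/
lemma apply_eq_quadraticChar {p : ℕ} [hp : Fact p.Prime] {χ : DirichletCharacter ℂ p}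
    (hχ : χ.IsQuadratic) (h1 : χ ≠ 1) (x : ZMod p) : χ x = (quadraticChar (ZMod p) x : ℤ) := by
  have hsq : ∀ y : ZMod p, y ≠ 0 → IsSquare y → χ y = 1 := by
    rintro y hy ⟨w, rfl⟩
    have hw : IsUnit w := (left_ne_zero_of_mul hy).isUnit
    rw [map_mul]
    rcases apply_unit_of_isQuadratic hχ hw with h | h <;> rw [h] <;> norm_num
  rcases eq_or_ne x 0 with rfl | hx
  · rw [MulChar.map_nonunit _ not_isUnit_zero]; simp
  · obtain ⟨u, hu⟩ := MulChar.ne_one_iff.1 h1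
    have hu' := (apply_unit_of_isQuadratic hχ u.isUnit).resolve_left hu
    have hnu : quadraticChar (ZMod p) u = -1 := by
      refine (quadraticChar_dichotomy u.ne_zero).resolve_left fun h => hu ?_
      exact hsq _ u.ne_zero ((quadraticChar_one_iff_isSquare u.ne_zero).1 h)
    rcases quadraticChar_dichotomy hx with h | h
    · rw [h, hsq x hx ((quadraticChar_one_iff_isSquare hx).1 h)]; simp
    · have h2 : χ (x * u) = 1 := by
        refine hsq _ (mul_ne_zero hx u.ne_zero) ?_
        rw [← quadraticChar_one_iff_isSquare (mul_ne_zero hx u.ne_zero), map_mul, h, hnu]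
        norm_num
      rw [map_mul, hu'] at h2
      rw [h]
      push_cast
      linear_combination -h2

/-- The Gauss sum `∑ χ(x) ψ(x)` equals `∑ ψ(y²)`, because `1 + χ(x)` counts the square roots
of `x`. -/
lemma gaussSum_quadratic_prime {p : ℕ} [hp : Fact p.Prime] (hodd : p ≠ 2)
    {χ : DirichletCharacter ℂ p} (hχ : χ.IsQuadratic) (h1 : χ ≠ 1) :
    gaussSum χ ZMod.stdAddChar =
      (Real.sqrt p : ℂ) * (1 + (-Complex.I) ^ p) / (1 - Complex.I) := by
  have hchar : ringChar (ZMod p) ≠ 2 := by rwa [ZMod.ringChar_zmod_n]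
  rw [← sum_exp_sq_div]
  have hψ : ∑ x : ZMod p, (ZMod.stdAddChar x : ℂ) = 0 := by
    refine AddChar.sum_eq_zero_of_ne_one ?_
    have := ZMod.isPrimitive_stdAddChar p one_ne_zero
    rwa [AddChar.mulShift_one] at this
  have hcount : ∀ x : ZMod p, χ x =
      (∑ y : ZMod p, if y ^ 2 = x then (1 : ℂ) else 0) - 1 := by
    intro x
    have := quadraticChar_card_sqrts hchar x
    rw [apply_eq_quadraticChar hχ h1, eq_sub_iff_add_eq.2 this.symm, Finset.sum_boole]
    push_cast
    congr 3
    ext; simp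
  have hsum : gaussSum χ ZMod.stdAddChar = ∑ y : ZMod p, (ZMod.stdAddChar (y ^ 2) : ℂ) := by
    simp only [gaussSum, hcount, sub_mul, one_mul, Finset.sum_sub_distrib, hψ, sub_zero]
    simp only [Finset.sum_mul, ite_mul, one_mul, zero_mul]
    rw [Finset.sum_comm]
    simp
  rw [hsum]
  symm
  refine Fintype.sum_bijective _ (bijective_natCast_fin p) _ _ fun r => ?_
  have := ZMod.stdAddChar_coe (N := p) ((r : ℕ) ^ 2 : ℤ)
  push_cast at this
  rw [this]

/-! ### The root number of a primitive quadratic character -/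

lemma ne_one_of_isPrimitive {n : ℕ} (hn : n ≠ 1) [NeZero n] {χ : DirichletCharacter ℂ n}
    (hp : χ.IsPrimitive) : χ ≠ 1 := by
  rintro rfl
  rw [isPrimitive_def, conductor_one] at hp
  exact hn hp.symm

/-- Primitive quadratic characters of odd modulus are Jacobi symbols, and their Gauss sums have
the standard value. Quadratic reciprocity for the Jacobi symbol carries the induction over coprime
factors. -/
theorem eq_jacobiSym_and_hasStandardGaussSum (q : ℕ) : ∀ [NeZero q], _root_.Odd q →
    ∀ χ : DirichletCharacter ℂ q, χ.IsQuadratic → χ.IsPrimitive →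
      (∀ n : ℤ, χ n = (jacobiSym n q : ℤ)) ∧ HasStandardGaussSum χ := by
  induction q using Nat.recOnPosPrimePosCoprime with
  | prime_pow p n hp hn =>
    intro hne
    by_cases hn1 : n = 1
    swap
    · intro hodd χ hχ hprim
      exact absurd hprim
        (not_isPrimitive_prime_pow hp ((Nat.odd_pow_iff hn.ne').1 hodd) (by omega) hχ)
    subst hn1
    revert hne
    rw [pow_one]
    intro _ hpo χ hχ hprim
    have : Fact p.Prime := ⟨hp⟩
    have h1 := ne_one_of_isPrimitive hp.one_lt.ne' hprim
    have hp2 : p ≠ 2 := by rintro rfl; exact absurd hpo (by decide)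
    have hval : ∀ n : ℤ, χ n = (jacobiSym n p : ℤ) := by
      intro n
      rw [apply_eq_quadraticChar hχ h1, ← jacobiSym.legendreSym.to_jacobiSym]
      rfl
    have hG := gaussSum_quadratic_prime hp2 hχ h1
    have hm1 : χ (-1) = (ZMod.χ₄ p : ℤ) := by
      rw [← jacobiSym.at_neg_one hpo, ← hval]; simp
    have hI : (1 - Complex.I) ≠ 0 := by
      intro h; have := congrArg Complex.re h; simp at this
    have hI4 : (-Complex.I) ^ 4 = 1 := by
      linear_combination (Complex.I ^ 2 - 1) * Complex.I_sq
    refine ⟨hval, ?_⟩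
    rcases Nat.odd_mod_four_iff.1 (Nat.odd_iff.1 hpo) with h4 | h4
    · rw [ZMod.χ₄_nat_one_mod_four h4] at hm1
      refine ⟨fun _ => ?_, fun ho => ?_⟩
      · have : (-Complex.I) ^ p = -Complex.I := by
          rw [← Nat.div_add_mod p 4, h4, pow_add, pow_mul, hI4, one_pow, one_mul, pow_one]
        rw [hG, this]
        field_simp
        ring
      · rw [Odd, hm1] at ho; norm_num at ho
    · rw [ZMod.χ₄_nat_three_mod_four h4] at hm1
      refine ⟨fun ho => ?_, fun _ => ?_⟩
      · rw [Even, hm1] at ho; norm_num at ho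
      · have : (-Complex.I) ^ p = Complex.I := by
          rw [← Nat.div_add_mod p 4, h4, pow_add, pow_mul, hI4, one_pow, one_mul]
          linear_combination (-Complex.I) * Complex.I_sq
        rw [hG, this]
        field_simp
        linear_combination (Real.sqrt p : ℂ) * Complex.I_sq
  | zero => intro h; exact absurd rfl (NeZero.ne 0)
  | one =>
    intro _ _ χ _ _
    obtain rfl := level_one χ
    refine ⟨fun n => ?_, fun _ => ?_, fun ho => ?_⟩
    · rw [jacobiSym.one_right, MulChar.one_apply (isUnit_of_subsingleton _)]; simp
    · simp only [gaussSum, Fintype.sum_unique]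
      rw [MulChar.one_apply (isUnit_of_subsingleton _), one_mul, Nat.cast_one, Real.sqrt_one]
      exact AddChar.map_zero_eq_one _
    · rw [Odd, MulChar.one_apply (isUnit_of_subsingleton _)] at ho; norm_num at ho
  | coprime a b ha hb hab iha ihb =>
    intro _ hodd χ hχ hprim
    have : NeZero a := ⟨by omega⟩
    have : NeZero b := ⟨by omega⟩
    have hao : _root_.Odd a := Nat.Odd.of_mul_left hodd
    have hbo : _root_.Odd b := Nat.Odd.of_mul_right hodd
    obtain ⟨hpa, hpb⟩ := isPrimitive_crt hab χ hprim
    obtain ⟨hva, hga⟩ := iha hao _ (isQuadratic_crtLeft hab χ hχ) hpa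
    obtain ⟨hvb, hgb⟩ := ihb hbo _ (isQuadratic_crtRight hab χ hχ) hpb
    refine ⟨fun n => ?_, HasStandardGaussSum.of_crt hab χ hga hgb ?_ ?_⟩
    · rw [apply_intCast_eq_crt hab, hva, hvb, jacobiSym.mul_right, Int.cast_mul]
    all_goals
      have hxa := hva b
      have hxb := hvb a
      rw [Int.cast_natCast] at hxa hxb
      rw [hxa, hxb]
      have hma := hva (-1)
      have hmb := hvb (-1)
      rw [jacobiSym.at_neg_one hao] at hma
      rw [jacobiSym.at_neg_one hbo] at hmb
      rw [Int.cast_neg, Int.cast_one] at hma hmb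
      have hsq : (jacobiSym a b : ℂ) * jacobiSym a b = 1 := by
        have := jacobiSym.sq_one (a := a) (b := b) (by simpa using hab)
        rw [← sq]; exact_mod_cast this
      simp only [Even, Odd, hma, hmb]
    · have hrec : jacobiSym b a = jacobiSym a b → (jacobiSym b a : ℂ) * jacobiSym a b = 1 := by
        intro h; rw [h, hsq]
      rintro (h | h)
      · refine hrec ?_
        rcases Nat.odd_mod_four_iff.1 (Nat.odd_iff.1 hao) with h4 | h4
        · exact (jacobiSym.quadratic_reciprocity_one_mod_four h4 hbo).symm
        · rw [ZMod.χ₄_nat_three_mod_four h4] at h; norm_num at h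
      · refine hrec ?_
        rcases Nat.odd_mod_four_iff.1 (Nat.odd_iff.1 hbo) with h4 | h4
        · exact jacobiSym.quadratic_reciprocity_one_mod_four h4 hao
        · rw [ZMod.χ₄_nat_three_mod_four h4] at h; norm_num at h
    · intro h h'
      rcases Nat.odd_mod_four_iff.1 (Nat.odd_iff.1 hao) with h4 | h4
      · rw [ZMod.χ₄_nat_one_mod_four h4] at h; norm_num at h
      rcases Nat.odd_mod_four_iff.1 (Nat.odd_iff.1 hbo) with h4' | h4'
      · rw [ZMod.χ₄_nat_one_mod_four h4'] at h'; norm_num at h'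
      rw [jacobiSym.quadratic_reciprocity_three_mod_four h4' h4]
      push_cast
      rw [neg_mul, hsq]

lemma eq_χ₄_of_isQuadratic {χ : DirichletCharacter ℂ 4} (hχ : χ.IsQuadratic) (h1 : χ ≠ 1)
    (x : ZMod 4) : χ x = (ZMod.χ₄ x : ℤ) := by
  have h0 : χ 0 = 0 := MulChar.map_nonunit _ (by decide)
  have h2 : χ 2 = 0 := MulChar.map_nonunit _ (by decide)
  have h3 : χ 3 = -1 := by
    refine (apply_unit_of_isQuadratic hχ (by decide)).resolve_left fun h3 => h1 ?_
    ext u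
    rw [MulChar.one_apply_coe]
    have : (u : ZMod 4) = 1 ∨ (u : ZMod 4) = 3 := by revert u; decide
    rcases this with h | h <;> rw [h]
    · exact map_one χ
    · exact h3
  have hcases : ∀ x : ZMod 4, x = 0 ∨ x = 1 ∨ x = 2 ∨ x = 3 := by decide
  rcases hcases x with rfl | rfl | rfl | rfl
  · rw [h0, show ZMod.χ₄ 0 = 0 by decide, Int.cast_zero]
  · rw [map_one, map_one, Int.cast_one]
  · rw [h2, show ZMod.χ₄ 2 = 0 by decide, Int.cast_zero]
  · rw [h3, show ZMod.χ₄ 3 = -1 by decide, Int.cast_neg, Int.cast_one]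

/-- A primitive quadratic character modulo `8` is determined by its value at `3`, since its value
at `5` is `-1`: otherwise it would factor through modulus `4`. -/
lemma eq_χ₈_of_isPrimitive {χ : DirichletCharacter ℂ 8} (hχ : χ.IsQuadratic)
    (hp : χ.IsPrimitive) :
    (∀ x, χ x = (ZMod.χ₈ x : ℤ)) ∨ (∀ x, χ x = (ZMod.χ₈' x : ℤ)) := by
  have h5 : χ 5 = -1 := by
    refine (apply_unit_of_isQuadratic hχ (by decide)).resolve_left fun h5 => ?_
    refine not_isPrimitive_of_factorsThrough (d := 4) (by norm_num) ?_ hp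
    rw [factorsThrough_iff_castHom _ (by norm_num)]
    intro u hu
    have : (u : ZMod 8) = 1 ∨ (u : ZMod 8) = 5 := by revert u; decide
    rcases this with h | h <;> rw [h]
    · exact map_one χ
    · exact h5
  have h7 : χ 7 = χ 3 * χ 5 := by rw [← map_mul]; rfl
  have hz : ∀ x : ZMod 8, ¬ IsUnit x → χ x = 0 := fun x hx => MulChar.map_nonunit _ hx
  have hcases : ∀ x : ZMod 8, ¬ IsUnit x ∨ x = 1 ∨ x = 3 ∨ x = 5 ∨ x = 7 := by decide
  rcases apply_unit_of_isQuadratic hχ (x := 3) (by decide) with h3 | h3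
  · right
    intro x
    rcases hcases x with h | rfl | rfl | rfl | rfl
    · rw [hz x h, MulChar.map_nonunit _ h]; simp
    · simp
    · rw [h3, show ZMod.χ₈' 3 = 1 by decide]; simp
    · rw [h5, show ZMod.χ₈' 5 = -1 by decide]; simp
    · rw [h7, h3, h5, show ZMod.χ₈' 7 = -1 by decide]; simp
  · left
    intro x
    rcases hcases x with h | rfl | rfl | rfl | rfl
    · rw [hz x h, MulChar.map_nonunit _ h]; simp
    · simp
    · rw [h3, show ZMod.χ₈ 3 = -1 by decide]; simp
    · rw [h5, show ZMod.χ₈ 5 = -1 by decide]; simp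
    · rw [h7, h3, h5, show ZMod.χ₈ 7 = 1 by decide]; simp

lemma hasStandardGaussSum_four {χ : DirichletCharacter ℂ 4} (hv : ∀ x, χ x = (ZMod.χ₄ x : ℤ)) :
    HasStandardGaussSum χ := by
  have hm : χ (-1) = -1 := by rw [hv, show ZMod.χ₄ (-1) = -1 by decide]; simp
  refine ⟨fun h => ?_, fun _ => ?_⟩
  · rw [Even, hm] at h; norm_num at h
  · have hI : (ZMod.stdAddChar (1 : ZMod 4) : ℂ) = Complex.I := by
      have := ZMod.stdAddChar_coe (N := 4) 1
      push_cast at this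
      rw [this, show 2 * (Real.pi : ℂ) * Complex.I * 1 / 4 = Real.pi / 2 * Complex.I by ring,
        Complex.exp_pi_div_two_mul_I]
    have hI3 : (ZMod.stdAddChar (3 : ZMod 4) : ℂ) = Complex.I ^ 3 := by
      rw [← hI, ← AddChar.map_nsmul_eq_pow]; rfl
    have hu : (Finset.univ : Finset (ZMod 4)) = {0, 1, 2, 3} := by decide
    have hs : Real.sqrt (4 : ℕ) = 2 := by
      rw [show ((4 : ℕ) : ℝ) = 2 ^ 2 by norm_num, Real.sqrt_sq (by norm_num)]
    simp only [gaussSum, hu, hv]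
    rw [Finset.sum_insert (by decide), Finset.sum_insert (by decide), Finset.sum_insert (by decide),
      Finset.sum_singleton, hI, hI3, hs, show ZMod.χ₄ 0 = 0 by decide, show ZMod.χ₄ 1 = 1 by decide,
      show ZMod.χ₄ 2 = 0 by decide, show ZMod.χ₄ 3 = -1 by decide]
    push_cast
    linear_combination (-Complex.I) * Complex.I_sq

lemma stdAddChar_eight_pow (k : ℕ) : (ZMod.stdAddChar (k : ZMod 8) : ℂ) =
    ((Real.sqrt 2 : ℂ) / 2 * (1 + Complex.I)) ^ k := by
  have h1 : (ZMod.stdAddChar (1 : ZMod 8) : ℂ) = (Real.sqrt 2 : ℂ) / 2 * (1 + Complex.I) := by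
    have := ZMod.stdAddChar_coe (N := 8) 1
    push_cast at this
    rw [this, show 2 * (Real.pi : ℂ) * Complex.I * 1 / 8 =
      ((Real.pi / 4 : ℝ) : ℂ) * Complex.I by push_cast; ring, Complex.exp_mul_I,
      ← Complex.ofReal_cos, ← Complex.ofReal_sin, Real.cos_pi_div_four, Real.sin_pi_div_four]
    push_cast
    ring
  rw [← h1, ← AddChar.map_nsmul_eq_pow, nsmul_one]

lemma gaussSum_eight (χ : DirichletCharacter ℂ 8) :
    gaussSum χ ZMod.stdAddChar = (Real.sqrt 2 : ℂ) / 2 *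
      (χ 1 * (1 + Complex.I) + χ 3 * (-1 + Complex.I) - χ 5 * (1 + Complex.I) +
        χ 7 * (1 - Complex.I)) := by
  have hu : (Finset.univ : Finset (ZMod 8)) = {0, 1, 2, 3, 4, 5, 6, 7} := by decide
  have hz : ∀ x : ZMod 8, ¬ IsUnit x → χ x = 0 := fun x hx => MulChar.map_nonunit _ hx
  have hs : (Real.sqrt 2 : ℂ) ^ 2 = 2 := by
    rw [← Complex.ofReal_pow, Real.sq_sqrt (by norm_num)]; simp
  have hw2 : ((Real.sqrt 2 : ℂ) / 2 * (1 + Complex.I)) ^ 2 = Complex.I := by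
    rw [mul_pow, div_pow, hs]
    linear_combination (1 / 2) * Complex.I_sq
  have e1 := stdAddChar_eight_pow 1
  have e3 := stdAddChar_eight_pow 3
  have e5 := stdAddChar_eight_pow 5
  have e7 := stdAddChar_eight_pow 7
  rw [pow_one] at e1
  rw [pow_succ, hw2] at e3
  rw [pow_succ, pow_mul _ 2 2, hw2] at e5
  rw [pow_succ, pow_mul _ 2 3, hw2] at e7
  push_cast at e1 e3 e5 e7
  norm_num at e1 e3 e5 e7
  simp only [gaussSum, hu]
  rw [Finset.sum_insert (by decide), Finset.sum_insert (by decide), Finset.sum_insert (by decide),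
    Finset.sum_insert (by decide), Finset.sum_insert (by decide), Finset.sum_insert (by decide),
    Finset.sum_insert (by decide), Finset.sum_singleton, hz 0 (by decide), hz 2 (by decide),
    hz 4 (by decide), hz 6 (by decide), e1, e3, e5, e7]
  linear_combination ((Real.sqrt 2 : ℂ) / 2 * (χ 3 - χ 7)) * Complex.I_sq

lemma sqrt_eight : (Real.sqrt (8 : ℕ) : ℂ) = 2 * (Real.sqrt 2 : ℂ) := by
  rw [show ((8 : ℕ) : ℝ) = 2 ^ 2 * 2 by norm_num, Real.sqrt_mul (by norm_num),
    Real.sqrt_sq (by norm_num)]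
  push_cast
  ring

lemma hasStandardGaussSum_eight {χ : DirichletCharacter ℂ 8} (hv : ∀ x, χ x = (ZMod.χ₈ x : ℤ)) :
    HasStandardGaussSum χ := by
  have hm : χ (-1) = 1 := by rw [hv, show ZMod.χ₈ (-1) = 1 by decide]; simp
  refine ⟨fun h => ?_, fun h => ?_⟩
  · rw [gaussSum_eight, sqrt_eight]
    simp only [hv, show ZMod.χ₈ 1 = 1 by decide, show ZMod.χ₈ 3 = -1 by decide,
      show ZMod.χ₈ 5 = -1 by decide, show ZMod.χ₈ 7 = 1 by decide]
    push_cast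
    ring
  · rw [Odd, hm] at h; norm_num at h

lemma hasStandardGaussSum_eight' {χ : DirichletCharacter ℂ 8} (hv : ∀ x, χ x = (ZMod.χ₈' x : ℤ)) :
    HasStandardGaussSum χ := by
  have hm : χ (-1) = -1 := by rw [hv, show ZMod.χ₈' (-1) = -1 by decide]; simp
  refine ⟨fun h => ?_, fun h => ?_⟩
  · rw [Even, hm] at h; norm_num at h
  · rw [gaussSum_eight, sqrt_eight]
    simp only [hv, show ZMod.χ₈' 1 = 1 by decide, show ZMod.χ₈' 3 = 1 by decide,
      show ZMod.χ₈' 5 = -1 by decide, show ZMod.χ₈' 7 = -1 by decide]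
    push_cast
    ring

/-- The sign of the quadratic Gauss sum, for an arbitrary modulus: split off the power of `2`, which
is `1`, `4` or `8`, and use the supplementary laws of quadratic reciprocity for the cross values. -/
theorem hasStandardGaussSum_of_isPrimitive {q : ℕ} [NeZero q] {χ : DirichletCharacter ℂ q}
    (hχ : χ.IsQuadratic) (hprim : χ.IsPrimitive) : HasStandardGaussSum χ := by
  obtain ⟨k, m, hm, rfl⟩ := Nat.exists_eq_two_pow_mul_odd (NeZero.ne q)
  rcases Nat.eq_zero_or_pos k with rfl | hk
  · exact (eq_jacobiSym_and_hasStandardGaussSum _ (by simpa using hm) χ hχ hprim).2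
  have : NeZero m := ⟨by rintro rfl; exact absurd hm (by decide)⟩
  have hcop : (2 ^ k).Coprime m := Nat.Coprime.pow_left _ (Nat.coprime_two_left.2 hm)
  obtain ⟨hpa, hpb⟩ := isPrimitive_crt hcop χ hprim
  have hqa := isQuadratic_crtLeft hcop χ hχ
  obtain ⟨hvb, hgb⟩ := eq_jacobiSym_and_hasStandardGaussSum m hm _
    (isQuadratic_crtRight hcop χ hχ) hpb
  have hk3 : k ≤ 3 := by
    by_contra h
    exact not_isPrimitive_two_pow (by omega) hqa hpa
  have hmb := hvb (-1)
  rw [jacobiSym.at_neg_one hm, Int.cast_neg, Int.cast_one] at hmb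
  have hva2 := hvb (2 ^ k : ℕ)
  rw [Int.cast_natCast] at hva2
  have h2sq : (jacobiSym 2 m : ℂ) * jacobiSym 2 m = 1 := by
    have := jacobiSym.sq_one (a := 2) (b := m) (Nat.coprime_two_left.2 hm)
    rw [← sq]; exact_mod_cast this
  interval_cases k
  · -- there is no primitive character modulo `2`
    exfalso
    refine ne_one_of_isPrimitive (by norm_num) hpa ?_
    ext u
    have : ∀ u : (ZMod (2 ^ 1))ˣ, (u : ZMod (2 ^ 1)) = 1 := by decide
    rw [this u, map_one, map_one]
  · have hv := eq_χ₄_of_isQuadratic (χ := crtLeft hcop χ) hqa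
      (ne_one_of_isPrimitive (by norm_num) hpa)
    have hma : crtLeft hcop χ (-1) = -1 := by
      rw [show (-1 : ZMod (2 ^ 2)) = (3 : ZMod 4) from rfl, hv]
      simp [show ZMod.χ₄ 3 = -1 by decide]
    have hcross : crtLeft hcop χ m * crtRight hcop χ ((2 ^ 2 : ℕ) : ZMod m) =
        crtRight hcop χ (-1) := by
      rw [hva2, hmb, show ((2 ^ 2 : ℕ) : ℤ) = 4 by norm_num, jacobiSym.at_four hm, Int.cast_one,
        mul_one]
      exact hv m
    refine HasStandardGaussSum.of_crt hcop χ (hasStandardGaussSum_four (χ := crtLeft hcop χ) hv)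
      hgb ?_ ?_ <;> rw [hcross] <;> simp only [Even, Odd, hma]
    · rintro (h | h)
      · norm_num at h
      · exact h
    · exact fun _ h => h
  · have h8 : jacobiSym ((2 ^ 3 : ℕ) : ℤ) m = jacobiSym 2 m * (jacobiSym 2 m * jacobiSym 2 m) := by
      rw [← jacobiSym.mul_left, ← jacobiSym.mul_left]; norm_num
    have h8' : crtRight hcop χ ((2 ^ 3 : ℕ) : ZMod m) = (jacobiSym 2 m : ℂ) := by
      rw [hva2, h8]; push_cast; rw [h2sq, mul_one]
    rcases eq_χ₈_of_isPrimitive (χ := crtLeft hcop χ) hqa hpa with hv | hv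
    · have hma : crtLeft hcop χ (-1) = 1 := by
        rw [show (-1 : ZMod (2 ^ 3)) = (7 : ZMod 8) from rfl, hv]
        simp [show ZMod.χ₈ 7 = 1 by decide]
      have hcross : crtLeft hcop χ m * crtRight hcop χ ((2 ^ 3 : ℕ) : ZMod m) = 1 := by
        rw [h8', ← h2sq, jacobiSym.at_two hm]
        congr 1
        exact hv m
      refine HasStandardGaussSum.of_crt hcop χ (hasStandardGaussSum_eight (χ := crtLeft hcop χ) hv)
        hgb (fun _ => hcross) fun h => ?_
      rw [Odd, hma] at h; norm_num at h
    · have hma : crtLeft hcop χ (-1) = -1 := by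
        rw [show (-1 : ZMod (2 ^ 3)) = (7 : ZMod 8) from rfl, hv]
        simp [show ZMod.χ₈' 7 = -1 by decide]
      have hcross : crtLeft hcop χ m * crtRight hcop χ ((2 ^ 3 : ℕ) : ZMod m) =
          crtRight hcop χ (-1) := by
        have h1 : crtLeft hcop χ m = (ZMod.χ₈' m : ℤ) := hv m
        rw [h8', hmb, h1, ← jacobiSym.at_neg_two hm, ← jacobiSym.at_neg_one hm,
          show (-2 : ℤ) = -1 * 2 by norm_num, jacobiSym.mul_left]
        push_cast
        rw [mul_assoc, h2sq, mul_one]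
      refine HasStandardGaussSum.of_crt hcop χ
        (hasStandardGaussSum_eight' (χ := crtLeft hcop χ) hv) hgb ?_ ?_ <;>
        rw [hcross] <;> simp only [Even, Odd, hma]
      · rintro (h | h)
        · norm_num at h
        · exact h
      · exact fun _ h => h

/-- The functional equation of a primitive quadratic character has sign `+1`. -/
theorem rootNumber_eq_one {q : ℕ} [NeZero q] {χ : DirichletCharacter ℂ q}
    (hχ : χ.IsQuadratic) (hprim : χ.IsPrimitive) : rootNumber χ = 1 := by
  have hG := hasStandardGaussSum_of_isPrimitive hχ hprim
  have hq : (0 : ℝ) < q := Nat.cast_pos.2 (Nat.pos_of_ne_zero (NeZero.ne q))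
  have hs : (q : ℂ) ^ (1 / 2 : ℂ) = (Real.sqrt q : ℂ) := by
    rw [Real.sqrt_eq_rpow, Complex.ofReal_cpow hq.le]; push_cast; rfl
  have h0 : (Real.sqrt q : ℂ) ≠ 0 := Complex.ofReal_ne_zero.2 (Real.sqrt_pos.2 hq).ne'
  rw [rootNumber, hs]
  split_ifs with he
  · rw [hG.1 he, pow_zero, div_one, div_self h0]
  · rw [hG.2 (χ.even_or_odd.resolve_left he), pow_one, mul_div_cancel_left₀ _ Complex.I_ne_zero,
      div_self h0]

end DirichletCharacter

/-! ### Kummer's function -/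

namespace CharXi

lemma ascPochhammer_eval_succ_left (n : ℕ) (a : ℂ) :
    (ascPochhammer ℂ (n + 1)).eval a = a * (ascPochhammer ℂ n).eval (a + 1) := by
  rw [ascPochhammer_succ_left]; simp

lemma add_natCast_ne_zero {c : ℂ} (hc : 0 < c.re) (n : ℕ) : c + n ≠ 0 := by
  intro h
  have := congrArg Complex.re h
  simp at this
  have h2 : (0 : ℝ) ≤ n := n.cast_nonneg
  linarith

lemma ascPochhammer_eval_ne_zero {c : ℂ} (hc : 0 < c.re) (n : ℕ) :
    (ascPochhammer ℂ n).eval c ≠ 0 := by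
  induction n with
  | zero => simp
  | succ n ih =>
    rw [ascPochhammer_succ_eval]
    exact mul_ne_zero ih (add_natCast_ne_zero hc n)

lemma Gamma_add_natCast {w : ℂ} (hw : 0 < w.re) (k : ℕ) :
    Complex.Gamma (w + k) = (ascPochhammer ℂ k).eval w * Complex.Gamma w := by
  induction k with
  | zero => simp
  | succ k ih =>
    rw [Nat.cast_succ, ← add_assoc, Complex.Gamma_add_one _ (add_natCast_ne_zero hw k), ih,
      ascPochhammer_succ_eval]
    ring

/-- Convergence of Kummer's series by the ratio test. The bound `1 / 2 ≤ Re c` covers the two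
parameters `c = 1/2` and `c = 3/2` in use, and gives `|c + n| ≥ n + 1/2`. -/
lemma summable_norm_kummer (a w : ℂ) {c : ℂ} (hc : 1 / 2 ≤ c.re) :
    Summable fun n : ℕ => ‖(ascPochhammer ℂ n).eval a / (ascPochhammer ℂ n).eval c *
      (w ^ n / (n.factorial : ℂ))‖ := by
  have hc0 : 0 < c.re := by linarith
  refine summable_of_ratio_norm_eventually_le (r := 1 / 2) (by norm_num) ?_
  obtain ⟨N, hN⟩ := exists_nat_gt (2 * ((2 * ‖a‖ + 1) * ‖w‖))
  filter_upwards [eventually_ge_atTop N] with n hn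
  rw [norm_norm, norm_norm, ascPochhammer_succ_eval, ascPochhammer_succ_eval, pow_succ,
    Nat.factorial_succ]
  have hn' : (N : ℝ) ≤ n := by exact_mod_cast hn
  have hn0 : (0 : ℝ) ≤ n := n.cast_nonneg
  set A := (ascPochhammer ℂ n).eval a
  set C := (ascPochhammer ℂ n).eval c
  have h1 : A * (a + n) / (C * (c + n)) * (w ^ n * w / (((n + 1) * n.factorial : ℕ) : ℂ)) =
      ((a + n) / (c + n) * (w / (n + 1))) * (A / C * (w ^ n / n.factorial)) := by
    push_cast
    rw [mul_div_mul_comm, mul_comm ((n : ℂ) + 1), mul_div_mul_comm]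
    ring
  rw [h1, norm_mul]
  refine mul_le_mul_of_nonneg_right ?_ (norm_nonneg _)
  have h2 : n + 1 / 2 ≤ ‖c + n‖ := by
    refine le_trans ?_ (Complex.re_le_norm _)
    simp; linarith
  have h3 : ‖a + n‖ ≤ ‖a‖ + n := by
    refine (norm_add_le _ _).trans ?_
    simp
  have h4 : ‖(n : ℂ) + 1‖ = n + 1 := by
    rw [show (n : ℂ) + 1 = ((n + 1 : ℝ) : ℂ) by push_cast; rfl, Complex.norm_real,
      Real.norm_of_nonneg (by positivity)]
  rw [norm_mul, norm_div, norm_div, h4]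
  have h5 : ‖a + n‖ / ‖c + n‖ ≤ 2 * ‖a‖ + 1 := by
    rw [div_le_iff₀ (by linarith)]
    have := norm_nonneg a
    nlinarith [mul_nonneg this hn0]
  calc ‖a + n‖ / ‖c + n‖ * (‖w‖ / (n + 1)) ≤ (2 * ‖a‖ + 1) * (‖w‖ / (n + 1)) := by gcongr
    _ = ((2 * ‖a‖ + 1) * ‖w‖) / (n + 1) := by ring
    _ ≤ 1 / 2 := by rw [div_le_iff₀ (by positivity)]; linarith

lemma hasSum_kummer (a w : ℂ) {c : ℂ} (hc : 1 / 2 ≤ c.re) :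
    HasSum (fun n : ℕ => (ascPochhammer ℂ n).eval a / (ascPochhammer ℂ n).eval c *
      (w ^ n / (n.factorial : ℂ))) (kummer a c w) :=
  (summable_norm_kummer a w hc).of_norm.hasSum

/-- Measurability in the first parameter is all that the integrals over the critical line need. -/
lemma measurable_kummer {c : ℂ} (hc : 1 / 2 ≤ c.re) (w : ℂ) :
    Measurable fun a => kummer a c w := by
  refine measurable_of_tendsto_metrizable (f := fun (N : ℕ) (a : ℂ) => ∑ n ∈ Finset.range N,
    (ascPochhammer ℂ n).eval a / (ascPochhammer ℂ n).eval c * (w ^ n / (n.factorial : ℂ)))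
    (fun N => ?_) ?_
  · refine Continuous.measurable ?_
    refine continuous_finsetSum _ fun n _ => ?_
    exact ((Polynomial.continuous _).div_const _).mul_const _
  · rw [tendsto_pi_nhds]
    exact fun a => (hasSum_kummer a w hc).tendsto_sum_nat

/-- The Chu–Vandermonde evaluation of `₂F₁(-n, b; c; 1)`. -/
lemma sum_choose_mul_ascPochhammer_div (n : ℕ) : ∀ {b c : ℂ}, 0 < c.re →
    ∑ j ∈ Finset.range (n + 1), (n.choose j : ℂ) *
      ((-1) ^ j * ((ascPochhammer ℂ j).eval b / (ascPochhammer ℂ j).eval c)) =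
      (ascPochhammer ℂ n).eval (c - b) / (ascPochhammer ℂ n).eval c := by
  induction n with
  | zero => intro b c _; simp
  | succ n ih =>
    intro b c hc
    have hc1 : 0 < (c + 1).re := by simp; linarith
    have h := Finset.sum_choose_succ_mul (fun j _ => (-1 : ℂ) ^ j *
      ((ascPochhammer ℂ j).eval b / (ascPochhammer ℂ j).eval c)) n
    rw [h, ih hc]
    have hc0 : c ≠ 0 := by rintro rfl; simp at hc
    have hstep : ∀ j ∈ Finset.range (n + 1), (n.choose j : ℂ) * ((-1) ^ (j + 1) *
        ((ascPochhammer ℂ (j + 1)).eval b / (ascPochhammer ℂ (j + 1)).eval c)) =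
        (-(b / c)) * ((n.choose j : ℂ) * ((-1) ^ j *
        ((ascPochhammer ℂ j).eval (b + 1) / (ascPochhammer ℂ j).eval (c + 1)))) := by
      intro j _
      rw [ascPochhammer_eval_succ_left, ascPochhammer_eval_succ_left, mul_div_mul_comm]
      ring
    rw [Finset.sum_congr rfl hstep, ← Finset.mul_sum, ih hc1]
    have e1 := ascPochhammer_succ_eval n c
    have e2 := ascPochhammer_eval_succ_left n c
    have e3 := ascPochhammer_succ_eval n (c - b)
    have hn0 := ascPochhammer_eval_ne_zero hc n
    have hn1 := ascPochhammer_eval_ne_zero hc1 n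
    have hcn := add_natCast_ne_zero hc n
    rw [show c + 1 - (b + 1) = c - b by ring]
    have e4 : (ascPochhammer ℂ n).eval (c + 1) = (ascPochhammer ℂ n).eval c * (c + n) / c := by
      rw [eq_div_iff hc0, ← e1, e2]; ring
    rw [e3, e1, e4]
    field_simp
    ring

/-- Kummer's transformation `₁F₁(a; c; w) = e^w ₁F₁(c - a; c; -w)`, from the Cauchy product of the
two series on the right and the Chu–Vandermonde identity. -/
theorem kummer_eq_exp_mul_kummer (a w : ℂ) {c : ℂ} (hc : 1 / 2 ≤ c.re) :
    kummer a c w = Complex.exp w * kummer (c - a) c (-w) := by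
  have hexp : Complex.exp w = ∑' n : ℕ, w ^ n / (n.factorial : ℂ) := by
    rw [Complex.exp_eq_exp_ℂ, NormedSpace.exp_eq_tsum_div]
  have hs : Summable fun n : ℕ => ‖w ^ n / (n.factorial : ℂ)‖ := by
    have := (Real.summable_pow_div_factorial ‖w‖)
    simpa [norm_div, norm_pow] using this
  rw [hexp, kummer, kummer, mul_comm, tsum_mul_tsum_eq_tsum_sum_antidiagonal_of_summable_norm
    (summable_norm_kummer _ _ hc) hs]
  refine tsum_congr fun n => ?_
  rw [Finset.Nat.sum_antidiagonal_eq_sum_range_succ_mk]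
  have h := sum_choose_mul_ascPochhammer_div n (b := c - a) (c := c) (by linarith)
  rw [sub_sub_cancel] at h
  rw [← h, Finset.sum_mul]
  refine Finset.sum_congr rfl fun j hj => ?_
  have hjn : j ≤ n := Nat.lt_succ_iff.1 (Finset.mem_range.1 hj)
  rw [Nat.cast_choose ℂ hjn, neg_pow w j, show w ^ n = w ^ j * w ^ (n - j) by
    rw [← pow_add, Nat.add_sub_cancel' hjn]]
  have h1 : (j.factorial : ℂ) ≠ 0 := Nat.cast_ne_zero.2 (Nat.factorial_ne_zero _)
  have h2 : ((n - j).factorial : ℂ) ≠ 0 := Nat.cast_ne_zero.2 (Nat.factorial_ne_zero _)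
  have h3 : (n.factorial : ℂ) ≠ 0 := Nat.cast_ne_zero.2 (Nat.factorial_ne_zero _)
  field_simp

lemma norm_Gamma_le {s : ℂ} (hs : 0 < s.re) : ‖Complex.Gamma s‖ ≤ Real.Gamma s.re := by
  rw [Complex.Gamma_eq_integral hs, Real.Gamma_eq_integral hs, Complex.GammaIntegral]
  refine (norm_integral_le_integral_norm _).trans (le_of_eq ?_)
  refine setIntegral_congr_fun measurableSet_Ioi fun x hx => ?_
  rw [norm_mul, Complex.norm_real, Real.norm_of_nonneg (Real.exp_pos _).le,
    Complex.norm_cpow_eq_rpow_re_of_pos hx]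
  simp

lemma norm_le_norm_add_natCast {w : ℂ} (hw : 0 ≤ w.re) (k : ℕ) : ‖w‖ ≤ ‖w + k‖ := by
  have hk : (0 : ℝ) ≤ k := k.cast_nonneg
  rw [← sq_le_sq₀ (norm_nonneg _) (norm_nonneg _), Complex.sq_norm, Complex.sq_norm,
    Complex.normSq_apply, Complex.normSq_apply]
  simp only [Complex.add_re, Complex.natCast_re, Complex.add_im, Complex.natCast_im, add_zero]
  nlinarith

/-- On vertical lines `Γ(w) ₁F₁(w; c; u)` decays at least quadratically: termwise,
`Γ(w) (w)ₙ = Γ(w + n)`, and two steps of the recurrence of `Γ` give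
`|Γ(w + n)| |w|² ≤ |Γ(w + n + 2)| ≤ Γ(Re w + n + 2)`. -/
lemma exists_norm_Gamma_mul_kummer_le {c : ℂ} (hc : 1 / 2 ≤ c.re) (u : ℂ) {σ : ℝ} (hσ : 0 < σ) :
    ∃ C, ∀ w : ℂ, w.re = σ → ‖Complex.Gamma w * kummer w c u‖ ≤ C / ‖w‖ ^ 2 := by
  set b : ℕ → ℝ := fun n => ‖(ascPochhammer ℂ n).eval ((σ + 2 : ℝ) : ℂ) /
    (ascPochhammer ℂ n).eval c * (u ^ n / (n.factorial : ℂ))‖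
  have hb : Summable b := summable_norm_kummer _ u hc
  refine ⟨Real.Gamma (σ + 2) * ∑' n, b n, fun w hw => ?_⟩
  have hw0 : 0 < w.re := hw ▸ hσ
  have hwn : 0 < ‖w‖ := norm_pos_iff.2 (by rintro rfl; simp at hw0)
  have h1 := (hasSum_kummer w u hc).mul_left (Complex.Gamma w)
  refine (h1.norm_le_of_bounded (hb.hasSum.mul_left (Real.Gamma (σ + 2) / ‖w‖ ^ 2))
    fun n => ?_).trans (le_of_eq (by ring))
  have hG : ‖Complex.Gamma w * (ascPochhammer ℂ n).eval w‖ ≤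
      Real.Gamma (σ + 2) * ‖(ascPochhammer ℂ n).eval ((σ + 2 : ℝ) : ℂ)‖ / ‖w‖ ^ 2 := by
    rw [mul_comm, ← Gamma_add_natCast hw0]
    have hne : w + n ≠ 0 := add_natCast_ne_zero hw0 n
    have hne1 : w + n + 1 ≠ 0 := by
      have := add_natCast_ne_zero hw0 (n + 1)
      push_cast at this; rwa [add_assoc]
    have e1 : Complex.Gamma (w + n + 1 + 1) = (w + n + 1) * ((w + n) * Complex.Gamma (w + n)) := by
      rw [Complex.Gamma_add_one _ hne1, Complex.Gamma_add_one _ hne]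
    have e2 : ‖Complex.Gamma (w + n + 1 + 1)‖ ≤
        Real.Gamma (σ + 2) * ‖(ascPochhammer ℂ n).eval ((σ + 2 : ℝ) : ℂ)‖ := by
      refine (norm_Gamma_le (by simp; have : (0 : ℝ) ≤ n := n.cast_nonneg; linarith)).trans ?_
      have hre : (w + n + 1 + 1).re = σ + 2 + n := by simp [hw]; ring
      have hpos : 0 < ((σ + 2 : ℝ) : ℂ).re := by rw [Complex.ofReal_re]; linarith
      have := Gamma_add_natCast hpos n
      rw [hre, ← Real.norm_of_nonneg (Real.Gamma_pos_of_pos (by positivity) :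
        0 < Real.Gamma (σ + 2 + n)).le, ← Complex.norm_real, ← Complex.Gamma_ofReal]
      push_cast at this ⊢
      rw [this, norm_mul, mul_comm]
      refine mul_le_mul_of_nonneg_right (le_of_eq ?_) (norm_nonneg _)
      rw [← Real.norm_of_nonneg (Real.Gamma_pos_of_pos (by positivity) :
        0 < Real.Gamma (σ + 2)).le, ← Complex.norm_real, ← Complex.Gamma_ofReal]
      push_cast
      rfl
    rw [le_div_iff₀ (by positivity)]
    refine le_trans ?_ e2
    rw [e1, norm_mul, norm_mul, sq]
    have h2 := norm_le_norm_add_natCast hw0.le n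
    have h3 : ‖w‖ ≤ ‖w + n + 1‖ := by
      have := norm_le_norm_add_natCast hw0.le (n + 1)
      push_cast at this; rwa [add_assoc]
    calc ‖Complex.Gamma (w + n)‖ * (‖w‖ * ‖w‖) ≤
        ‖Complex.Gamma (w + n)‖ * (‖w + n + 1‖ * ‖w + n‖) := by gcongr
      _ = _ := by ring
  rw [show Complex.Gamma w * ((ascPochhammer ℂ n).eval w / (ascPochhammer ℂ n).eval c *
    (u ^ n / (n.factorial : ℂ))) = (Complex.Gamma w * (ascPochhammer ℂ n).eval w) *
    (((ascPochhammer ℂ n).eval c)⁻¹ * (u ^ n / (n.factorial : ℂ))) by ring, norm_mul]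
  refine (mul_le_mul_of_nonneg_right hG (norm_nonneg _)).trans (le_of_eq ?_)
  simp only [b]
  rw [div_eq_mul_inv ((ascPochhammer ℂ n).eval ((σ + 2 : ℝ) : ℂ)), mul_assoc, norm_mul _ (_ * _)]
  ring

/-! ### The Mellin transform of a Gaussian times a hyperbolic function -/

lemma factorial_two_mul_add_eq {ν : ℕ} (hν : ν = 0 ∨ ν = 1) (k : ℕ) :
    ((2 * k + ν).factorial : ℂ) =
      4 ^ k * (k.factorial : ℂ) * (ascPochhammer ℂ k).eval (1 / 2 + ν : ℂ) := by
  induction k with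
  | zero => rcases hν with rfl | rfl <;> simp
  | succ k ih =>
    rw [show 2 * (k + 1) + ν = (2 * k + ν) + 1 + 1 by ring, Nat.factorial_succ, Nat.factorial_succ,
      Nat.cast_mul, Nat.cast_mul, ih, ascPochhammer_succ_eval, Nat.factorial_succ]
    rcases hν with rfl | rfl <;> push_cast <;> ring

lemma half_le_re_half_add (ν : ℕ) : 1 / 2 ≤ (1 / 2 + ν : ℂ).re := by
  have : (0 : ℝ) ≤ ν := ν.cast_nonneg
  simp

/-- Relates the Taylor coefficients of `cosh` (`ν = 0`) and `sinh` (`ν = 1`), integrated against a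
Gaussian, to the terms of Kummer's series. -/
lemma Gamma_mul_pow_div_factorial {ν : ℕ} (hν : ν = 0 ∨ ν = 1) {w : ℂ} (hw : 0 < w.re) (z : ℂ)
    (k : ℕ) : z ^ (2 * k + ν) / ((2 * k + ν).factorial : ℂ) * Complex.Gamma (w + k) =
      z ^ ν * Complex.Gamma w * ((ascPochhammer ℂ k).eval w /
        (ascPochhammer ℂ k).eval (1 / 2 + ν : ℂ) *
        ((z ^ 2 / 4) ^ k / (k.factorial : ℂ))) := by
  rw [factorial_two_mul_add_eq hν, Gamma_add_natCast hw, pow_add, pow_mul, div_pow]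
  have h1 := ascPochhammer_eval_ne_zero
    (lt_of_lt_of_le (by norm_num) (half_le_re_half_add ν)) k
  have h2 : (k.factorial : ℂ) ≠ 0 := Nat.cast_ne_zero.2 (Nat.factorial_ne_zero _)
  field_simp

/-- The product `e^{-x²} h(x z)`, for `h` one of `cosh` and `sinh`. -/
noncomputable def gaussMul (h : ℂ → ℂ) (z : ℂ) (x : ℝ) : ℂ :=
  Complex.exp (-(x : ℂ) ^ 2) * h (x * z)

lemma continuous_gaussMul {h : ℂ → ℂ} (hcont : Continuous h) (z : ℂ) :
    Continuous (gaussMul h z) := by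
  unfold gaussMul
  fun_prop

lemma norm_gaussMul_le {h : ℂ → ℂ} (hbd : ∀ w, ‖h w‖ ≤ Real.exp ‖w‖) (z : ℂ) {x : ℝ} (hx : 0 ≤ x) :
    ‖gaussMul h z x‖ ≤ Real.exp ((‖z‖ + 1) ^ 2 / 4) * Real.exp (-1 * x) := by
  rw [gaussMul, norm_mul, Complex.norm_exp, ← Real.exp_add]
  refine (mul_le_mul_of_nonneg_left (hbd _) (Real.exp_pos _).le).trans ?_
  rw [← Real.exp_add, norm_mul, Complex.norm_real, Real.norm_of_nonneg hx]
  refine Real.exp_le_exp.2 ?_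
  rw [← Complex.ofReal_pow, Complex.neg_re, Complex.ofReal_re]
  nlinarith [sq_nonneg (x - (‖z‖ + 1) / 2)]

lemma mellinConvergent_gaussMul {h : ℂ → ℂ} (hcont : Continuous h)
    (hbd : ∀ w, ‖h w‖ ≤ Real.exp ‖w‖) (z : ℂ) {s : ℂ} (hs : 0 < s.re) :
    MellinConvergent (gaussMul h z) s := by
  refine mellinConvergent_of_isBigO_rpow_exp (a := 1) (b := 0) one_pos
    ((continuous_gaussMul hcont z).locallyIntegrable.locallyIntegrableOn _) ?_ ?_ hs
  · refine Asymptotics.IsBigO.of_bound (Real.exp ((‖z‖ + 1) ^ 2 / 4)) ?_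
    filter_upwards [eventually_ge_atTop 0] with x hx
    rw [Real.norm_of_nonneg (Real.exp_pos _).le]
    exact norm_gaussMul_le hbd z hx
  · refine Asymptotics.IsBigO.of_bound (Real.exp ((‖z‖ + 1) ^ 2 / 4)) ?_
    filter_upwards [self_mem_nhdsWithin] with x hx
    have hx0 : (0 : ℝ) < x := hx
    rw [neg_zero, Real.rpow_zero, norm_one]
    refine (norm_gaussMul_le hbd z hx0.le).trans ?_
    gcongr
    rw [Real.exp_le_one_iff]
    linarith

lemma mellin_gaussian {s : ℂ} (hs : 0 < s.re) :
    MellinConvergent (fun x : ℝ => Complex.exp (-(x : ℂ) ^ 2)) s ∧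
      mellin (fun x : ℝ => Complex.exp (-(x : ℂ) ^ 2)) s = 1 / 2 * Complex.Gamma (s / 2) := by
  have he : (fun x : ℝ => Complex.exp (-(x : ℂ) ^ 2)) =
      fun x : ℝ => (fun y : ℝ => ((Real.exp (-y) : ℝ) : ℂ)) (x ^ (2 : ℝ)) := by
    ext x
    simp
  have hs2 : 0 < (s / (2 : ℝ)).re := by
    rw [Complex.div_ofReal_re]; positivity
  constructor
  · rw [he]
    refine (MellinConvergent.comp_rpow (f := fun y : ℝ => ((Real.exp (-y) : ℝ) : ℂ))
      two_ne_zero).2 ?_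
    have := Complex.GammaIntegral_convergent hs2
    refine this.congr_fun (fun x _ => ?_) measurableSet_Ioi
    rw [smul_eq_mul, mul_comm]
  · rw [he, mellin_comp_rpow (fun y : ℝ => ((Real.exp (-y) : ℝ) : ℂ)),
      ← Complex.GammaIntegral_eq_mellin, ← Complex.Gamma_eq_integral hs2]
    rw [abs_of_pos two_pos]
    simp

/-- The Mellin transform of `e^{-x²} cosh(x z)` (`ν = 0`) and `e^{-x²} sinh(x z)` (`ν = 1`), by
termwise integration. -/
theorem mellin_gaussMul {ν : ℕ} (hν : ν = 0 ∨ ν = 1) {h : ℂ → ℂ}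
    (hh : ∀ w, HasSum (fun k : ℕ => w ^ (2 * k + ν) / ((2 * k + ν).factorial : ℂ)) (h w)) (z : ℂ)
    {s : ℂ} (hs : 0 < s.re) :
    mellin (gaussMul h z) s =
      z ^ ν / 2 * (Complex.Gamma ((s + ν) / 2) * kummer ((s + ν) / 2) (1 / 2 + ν) (z ^ 2 / 4)) := by
  have hν0 : (0 : ℝ) ≤ ν := ν.cast_nonneg
  have hw : 0 < ((s + ν) / 2).re := by
    rw [show (s + ν) / 2 = (s + ν) / ((2 : ℝ) : ℂ) by push_cast; rfl, Complex.div_ofReal_re]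
    simp; linarith
  set e : ℝ → ℂ := fun x => Complex.exp (-(x : ℂ) ^ 2) with he
  set F : ℕ → ℝ → ℂ := fun k x => (x : ℂ) ^ (s - 1) •
    (e x * ((x * z) ^ (2 * k + ν) / ((2 * k + ν).factorial : ℂ))) with hF
  have hFeq : ∀ k : ℕ, ∀ x ∈ Ioi (0 : ℝ), F k x = z ^ (2 * k + ν) / ((2 * k + ν).factorial : ℂ) *
      ((x : ℂ) ^ (s - 1) • ((x : ℂ) ^ ((2 * k + ν : ℕ) : ℂ) • e x)) := by
    intro k x _
    simp only [hF, smul_eq_mul, Complex.cpow_natCast, mul_pow]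
    ring
  have hre : ∀ k : ℕ, 0 < (s + ((2 * k + ν : ℕ) : ℂ)).re := by
    intro k
    have : (0 : ℝ) ≤ (2 * k + ν : ℕ) := Nat.cast_nonneg _
    simp only [Complex.add_re, Complex.natCast_re]
    linarith
  have hint : ∀ k, Integrable (F k) (volume.restrict (Ioi 0)) := by
    intro k
    have h1 : MellinConvergent (fun x : ℝ => (x : ℂ) ^ ((2 * k + ν : ℕ) : ℂ) • e x) s :=
      MellinConvergent.cpow_smul.2 (mellin_gaussian (hre k)).1
    have h2 : IntegrableOn _ (Ioi (0 : ℝ)) volume :=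
      Integrable.const_mul h1 (z ^ (2 * k + ν) / ((2 * k + ν).factorial : ℂ))
    exact h2.congr_fun (fun x hx => (hFeq k x hx).symm) measurableSet_Ioi
  have hval : ∀ k, ∫ x in Ioi 0, F k x = z ^ ν / 2 * (Complex.Gamma ((s + ν) / 2) *
      ((ascPochhammer ℂ k).eval ((s + ν) / 2) / (ascPochhammer ℂ k).eval (1 / 2 + ν : ℂ) *
        ((z ^ 2 / 4) ^ k / (k.factorial : ℂ)))) := by
    intro k
    rw [setIntegral_congr_fun measurableSet_Ioi (hFeq k), integral_const_mul]
    have h1 := mellin_cpow_smul e s ((2 * k + ν : ℕ) : ℂ)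
    rw [(mellin_gaussian (hre k)).2, mellin] at h1
    rw [h1, show (s + ((2 * k + ν : ℕ) : ℂ)) / 2 = (s + ν) / 2 + k by push_cast; ring]
    have := Gamma_mul_pow_div_factorial hν hw z k
    linear_combination (1 / 2) * this
  have hsum : Summable fun k => ∫ x in Ioi 0, ‖F k x‖ := by
    have hw' : 0 < (((s.re + ν) / 2 : ℝ) : ℂ).re := by rw [Complex.ofReal_re]; positivity
    have h1 := ((summable_norm_kummer (((s.re + ν) / 2 : ℝ) : ℂ) ((‖z‖ : ℂ) ^ 2 / 4)
      (half_le_re_half_add ν)).mul_left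
        ‖(‖z‖ : ℂ) ^ ν / 2 * Complex.Gamma (((s.re + ν) / 2 : ℝ) : ℂ)‖)
    refine h1.congr fun k => ?_
    rw [← norm_mul]
    have h2 := Gamma_mul_pow_div_factorial hν hw' (‖z‖ : ℂ) k
    rw [show (‖z‖ : ℂ) ^ ν / 2 * Complex.Gamma (((s.re + ν) / 2 : ℝ) : ℂ) *
      ((ascPochhammer ℂ k).eval (((s.re + ν) / 2 : ℝ) : ℂ) /
        (ascPochhammer ℂ k).eval (1 / 2 + ν : ℂ) *
        (((‖z‖ : ℂ) ^ 2 / 4) ^ k / (k.factorial : ℂ))) = 1 / 2 * ((‖z‖ : ℂ) ^ (2 * k + ν) /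
        ((2 * k + ν).factorial : ℂ) * Complex.Gamma ((((s.re + ν) / 2 : ℝ) : ℂ) + k)) by
        rw [h2]; ring]
    have h3 : ∀ x ∈ Ioi (0 : ℝ), ‖F k x‖ = ‖z‖ ^ (2 * k + ν) / ((2 * k + ν).factorial : ℝ) *
        (x ^ (s.re - 1 + (2 * k + ν : ℕ)) * Real.exp (-x ^ (2 : ℝ))) := by
      intro x hx
      have hx0 : (0 : ℝ) < x := hx
      simp only [hF, he]
      rw [norm_smul, norm_mul, norm_div, norm_pow, norm_mul, Complex.norm_real,
        Complex.norm_cpow_eq_rpow_re_of_pos hx0, Complex.norm_exp, Real.norm_of_nonneg hx0.le,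
        Complex.norm_natCast, Real.rpow_add hx0, Real.rpow_natCast, mul_pow]
      rw [show (-(x : ℂ) ^ 2).re = -x ^ (2 : ℝ) by
        rw [← Complex.ofReal_pow, Complex.neg_re, Complex.ofReal_re, Real.rpow_two]]
      simp only [Complex.sub_re, Complex.one_re]
      ring
    have hk0 : (0 : ℝ) ≤ (2 * k + ν : ℕ) := Nat.cast_nonneg _
    rw [setIntegral_congr_fun measurableSet_Ioi h3, integral_const_mul,
      integral_rpow_mul_exp_neg_rpow two_pos (by linarith)]
    have h4 : ((s.re + ν) / 2 : ℝ) + (k : ℝ) = (s.re - 1 + (2 * k + ν : ℕ) + 1) / 2 := by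
      push_cast; ring
    have hpos : (0 : ℝ) < (s.re - 1 + (2 * k + ν : ℕ) + 1) / 2 := by linarith
    rw [← Complex.ofReal_natCast k, ← Complex.ofReal_add, h4, Complex.Gamma_ofReal]
    rw [norm_mul, norm_mul, norm_div _ (_ : ℂ), norm_div (_ ^ _), norm_pow, Complex.norm_real,
      Complex.norm_real, norm_norm, Complex.norm_natCast,
      Real.norm_of_nonneg (Real.Gamma_pos_of_pos hpos).le]
    norm_num
    ring
  have key := hasSum_integral_of_summable_integral_norm hint hsum
  simp_rw [hval] at key
  have key2 := ((hasSum_kummer ((s + ν) / 2) (z ^ 2 / 4) (half_le_re_half_add ν)).mul_left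
    (Complex.Gamma ((s + ν) / 2))).mul_left (z ^ ν / 2)
  rw [key2.unique key, mellin]
  refine setIntegral_congr_fun measurableSet_Ioi fun x _ => ?_
  simp only [hF, gaussMul]
  exact (((hh (x * z)).mul_left (e x)).const_smul ((x : ℂ) ^ (s - 1))).tsum_eq.symm

/-! ### Parseval's formula, and the Mellin transform of the weight -/

/-- Parseval's formula for the Mellin transform. -/
theorem integral_mul_eq_integral_mellin {f W : ℝ → ℂ} {σ : ℝ} (hfc : ContinuousOn f (Ioi 0))
    (hf : MellinConvergent f σ) (hv : Complex.VerticalIntegrable (mellin f) σ)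
    (hW : MellinConvergent W (1 - σ : ℂ)) :
    ∫ x in Ioi (0 : ℝ), f x * W x = 1 / (2 * Real.pi) *
      ∫ y : ℝ, mellin f (σ + y * Complex.I) * mellin W (1 - (σ + y * Complex.I)) := by
  have h1 : ∀ x ∈ Ioi (0 : ℝ), f x * W x = 1 / (2 * Real.pi) *
      ∫ y : ℝ, (x : ℂ) ^ (-(σ + y * Complex.I)) * mellin f (σ + y * Complex.I) * W x := by
    intro x hx
    have h2 := mellinInv_mellin_eq σ f hx hf hv (hfc.continuousAt (Ioi_mem_nhds hx))
    rw [integral_mul_const, ← mul_assoc]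
    congr 1
    rw [← h2, mellinInv, Complex.real_smul]
    push_cast
    rfl
  rw [setIntegral_congr_fun measurableSet_Ioi h1, integral_const_mul, integral_integral_swap]
  · congr 1
    refine integral_congr_ae (ae_of_all _ fun y => ?_)
    simp only [mellin, smul_eq_mul]
    rw [← integral_const_mul]
    refine integral_congr_ae (ae_of_all _ fun x => ?_)
    simp only
    rw [show (1 : ℂ) - (σ + y * Complex.I) - 1 = -(σ + y * Complex.I) by ring]
    ring
  · have hW' : Integrable (fun x : ℝ => (x : ℂ) ^ (-(σ : ℂ)) * W x) (volume.restrict (Ioi 0)) := by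
      have : IntegrableOn (fun x : ℝ => (x : ℂ) ^ ((1 - σ : ℂ) - 1) • W x) (Ioi 0) := hW
      simpa [sub_sub_cancel_left, IntegrableOn] using this
    have h3 := hW'.mul_prod hv
    have hmeas : AEStronglyMeasurable (fun p : ℝ × ℝ => (p.1 : ℂ) ^ (-(p.2 * Complex.I)))
        ((volume.restrict (Ioi 0)).prod volume) := by
      refine Measurable.aestronglyMeasurable ?_
      fun_prop
    have hae : ∀ᵐ p : ℝ × ℝ ∂((volume.restrict (Ioi 0)).prod volume), 0 < p.1 :=
      Measure.quasiMeasurePreserving_fst.ae (ae_restrict_mem measurableSet_Ioi)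
    have h4 := h3.bdd_mul (c := 1) hmeas (hae.mono fun p hp => by
      rw [Complex.norm_cpow_eq_rpow_re_of_pos hp]; simp)
    refine h4.congr (hae.mono fun p hp => ?_)
    have hp0 : (p.1 : ℂ) ≠ 0 := Complex.ofReal_ne_zero.2 hp.ne'
    simp only [Function.uncurry]
    rw [show -((σ : ℂ) + p.2 * Complex.I) = -(p.2 * Complex.I) + -σ by ring,
      Complex.cpow_add _ _ hp0]
    ring

section Weight

variable {q : ℕ} [NeZero q]

lemma sum_range_natCast (f : ZMod q → ℂ) : ∑ i ∈ Finset.range q, f i = ∑ x, f x := by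
  rw [Finset.sum_range]
  exact Fintype.sum_bijective _ (DirichletCharacter.bijective_natCast_fin q) _ _ fun _ => rfl

lemma sum_range_eq_sum_Icc {f : ℕ → ℂ} (hf : f 0 = 0) :
    ∑ i ∈ Finset.range q, f i = ∑ i ∈ Finset.Icc 1 (q - 1), f i := by
  have hq := Nat.pos_of_ne_zero (NeZero.ne q)
  rw [Finset.range_eq_Ico, Finset.sum_eq_sum_Ico_succ_bot hq, hf, zero_add]
  refine Finset.sum_congr ?_ fun _ _ => rfl
  ext i
  simp only [Finset.mem_Ico, Finset.mem_Icc]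
  omega

lemma character_zero {q : ℕ} (hq : 1 < q) (χ : DirichletCharacter ℂ q) :
    χ ((0 : ℕ) : ZMod q) = 0 := by
  rw [Nat.cast_zero]
  exact χ.map_zero' hq.ne'

/-- The weight is the generating series `∑ χ(n) e^{-2π n x / q}`, summed over residue classes. -/
lemma hasSum_weight (hq : 1 < q) (χ : DirichletCharacter ℂ q) {x : ℝ} (hx : 0 < x) :
    HasSum (fun n : ℕ => χ n * (Real.exp (-(2 * Real.pi * n / q) * x) : ℂ)) (weight χ x) := by
  have hq0 : (0 : ℝ) < q := by exact_mod_cast (by omega : 0 < q)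
  set y : ℝ := Real.exp (-(2 * Real.pi * x) / q) with hy
  have hy0 : 0 < y := Real.exp_pos _
  have hy1 : y < 1 := by
    rw [hy, Real.exp_lt_one_iff, neg_div, neg_lt_zero]
    have := Real.pi_pos
    positivity
  have hterm : ∀ n : ℕ, χ n * (Real.exp (-(2 * Real.pi * n / q) * x) : ℂ) = χ n * (y : ℂ) ^ n := by
    intro n
    rw [hy, ← Complex.ofReal_pow, ← Real.exp_nat_mul]
    congr 3
    ring
  have hs : Summable fun n : ℕ => χ n * (y : ℂ) ^ n := by
    refine Summable.of_norm_bounded (summable_geometric_of_lt_one hy0.le hy1) fun n => ?_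
    rw [norm_mul, norm_pow, Complex.norm_real, Real.norm_of_nonneg hy0.le]
    exact mul_le_of_le_one_left (by positivity) (χ.norm_le_one _)
  simp_rw [hterm]
  convert hs.hasSum using 1
  have h1 := hs.sum_add_tsum_nat_add q
  have h2 : ∀ n : ℕ, χ ((n + q : ℕ) : ZMod q) * (y : ℂ) ^ (n + q) =
      (y : ℂ) ^ q * (χ n * (y : ℂ) ^ n) := by
    intro n
    rw [Nat.cast_add, ZMod.natCast_self, add_zero, pow_add]
    ring
  simp_rw [h2] at h1
  rw [tsum_mul_left] at h1
  have hyq : y ^ q = Real.exp (-(2 * Real.pi * x)) := by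
    rw [hy, ← Real.exp_nat_mul]
    congr 1
    field_simp
  have hne : ((1 - Real.exp (-(2 * Real.pi * x)) : ℝ) : ℂ) ≠ 0 := by
    rw [← hyq, Complex.ofReal_ne_zero, sub_ne_zero]
    exact (pow_lt_one₀ hy0.le hy1 (by omega)).ne'
  rw [weight, div_eq_iff hne]
  have hnum : ∑ r ∈ Finset.Icc 1 (q - 1), χ (r : ZMod q) *
      (Real.exp (-(2 * Real.pi * r * x) / q) : ℂ) = ∑ i ∈ Finset.range q, χ i * (y : ℂ) ^ i := by
    rw [sum_range_eq_sum_Icc (by rw [character_zero hq, zero_mul])]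
    refine Finset.sum_congr rfl fun r _ => ?_
    rw [← hterm]
    congr 3
    ring
  rw [hnum, ← hyq]
  push_cast
  linear_combination h1

lemma weight_isBigO_atTop (χ : DirichletCharacter ℂ q) :
    weight χ =O[atTop] fun x => Real.exp (-(2 * Real.pi / q) * x) := by
  have hq0 : (0 : ℝ) < q := Nat.cast_pos.2 (Nat.pos_of_ne_zero (NeZero.ne q))
  have hpi := Real.pi_pos
  have h0 : 0 < 1 - Real.exp (-(2 * Real.pi)) := by
    rw [sub_pos, Real.exp_lt_one_iff]; linarith
  refine Asymptotics.IsBigO.of_bound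
    ((Finset.Icc 1 (q - 1)).card / (1 - Real.exp (-(2 * Real.pi)))) ?_
  filter_upwards [eventually_ge_atTop 1] with x hx
  have h1 : 1 - Real.exp (-(2 * Real.pi)) ≤ 1 - Real.exp (-(2 * Real.pi * x)) := by
    refine sub_le_sub_left (Real.exp_le_exp.2 ?_) 1
    nlinarith
  rw [weight, norm_div, Complex.norm_real, Real.norm_of_nonneg (h0.le.trans h1),
    Real.norm_of_nonneg (Real.exp_pos _).le, div_mul_eq_mul_div]
  refine div_le_div₀ (by positivity) ?_ h0 h1
  refine (norm_sum_le_of_le (n := fun _ => Real.exp (-(2 * Real.pi / q) * x)) _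
    fun r hr => ?_).trans (le_of_eq ?_)
  · rw [norm_mul, Complex.norm_real, Real.norm_of_nonneg (Real.exp_pos _).le]
    refine (mul_le_of_le_one_left (Real.exp_pos _).le (χ.norm_le_one _)).trans ?_
    rw [Real.exp_le_exp]
    have hr1 : (1 : ℝ) ≤ r := by exact_mod_cast (Finset.mem_Icc.1 hr).1
    have h2 : -(2 * Real.pi * r * x) / q = -(2 * Real.pi / q) * x * r := by ring
    rw [h2]
    have h3 : 0 < 2 * Real.pi / q * x := by positivity
    nlinarith
  · rw [Finset.sum_const, nsmul_eq_mul]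

/-- The weight is bounded near `0`, because the values of a nontrivial character sum to `0`. -/
lemma weight_isBigO_zero (hq : 1 < q) {χ : DirichletCharacter ℂ q} (hχ : χ ≠ 1) :
    weight χ =O[𝓝[>] 0] fun x => x ^ (-(0 : ℝ)) := by
  have hsum : ∑ r ∈ Finset.Icc 1 (q - 1), χ (r : ZMod q) = 0 := by
    rw [← sum_range_eq_sum_Icc (f := fun n : ℕ => χ n) (character_zero hq χ), sum_range_natCast χ,
      MulChar.sum_eq_zero_of_ne_one hχ]
  set N : ℝ → ℂ := fun x => ∑ r ∈ Finset.Icc 1 (q - 1), χ (r : ZMod q) *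
    (Real.exp (-(2 * Real.pi * r * x) / q) : ℂ) with hN
  set D : ℝ → ℂ := fun x => ((1 - Real.exp (-(2 * Real.pi * x)) : ℝ) : ℂ) with hD
  have hN0 : N 0 = 0 := by simp [hN, hsum]
  have hD0 : D 0 = 0 := by simp [hD]
  have hNd : DifferentiableAt ℝ N 0 := by
    simp only [hN]
    refine DifferentiableAt.fun_sum fun r _ => DifferentiableAt.const_mul ?_ _
    refine (HasDerivAt.ofReal_comp (f := fun x => Real.exp (-(2 * Real.pi * r * x) / q))
      (DifferentiableAt.hasDerivAt ?_)).differentiableAt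
    fun_prop
  have hDd : HasDerivAt D ((2 * Real.pi : ℝ) : ℂ) 0 := by
    refine HasDerivAt.ofReal_comp ?_
    have h1 : HasDerivAt (fun x : ℝ => -(2 * Real.pi * x)) (-(2 * Real.pi)) 0 := by
      have := ((hasDerivAt_id (0 : ℝ)).const_mul (-(2 * Real.pi)))
      simpa [neg_mul] using this
    simpa using (h1.exp).const_sub 1
  have h1 : N =O[𝓝 0] fun x => x := by
    simpa [hN0] using hNd.isBigO_sub
  have h2 : (fun x : ℝ => x) =O[𝓝 0] D := by
    have hpi := Real.pi_pos
    have := (HasDerivAtFilter.isTheta_sub hDd (by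
      rw [Complex.ofReal_ne_zero]; positivity)).2.comp_tendsto
        (tendsto_id.prodMk (tendsto_pure.2 (.of_forall fun _ => rfl)) :
          Tendsto (fun x : ℝ => (x, (0 : ℝ))) (𝓝 0) _)
    simpa [hD0, Function.comp_def] using this
  obtain ⟨C, hC⟩ := ((h1.trans h2).mono (nhdsWithin_le_nhds (s := Ioi 0))).bound
  refine Asymptotics.IsBigO.of_bound C ?_
  filter_upwards [hC, self_mem_nhdsWithin] with x hx hx0
  have hDx : D x ≠ 0 := by
    have hpi := Real.pi_pos
    have hx0' : (0 : ℝ) < x := hx0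
    rw [Complex.ofReal_ne_zero, sub_ne_zero]
    exact (Real.exp_lt_one_iff.2 (by rw [neg_lt_zero]; positivity)).ne'
  rw [neg_zero, Real.rpow_zero, norm_one, mul_one, weight, norm_div]
  exact (div_le_iff₀ (norm_pos_iff.2 hDx)).2 hx

lemma locallyIntegrableOn_weight {q : ℕ} (χ : DirichletCharacter ℂ q) :
    LocallyIntegrableOn (weight χ) (Ioi 0) := by
  refine ContinuousOn.locallyIntegrableOn ?_ measurableSet_Ioi
  refine ContinuousOn.div (by fun_prop) (by fun_prop) fun x hx => ?_
  have hpi := Real.pi_pos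
  have hx0' : (0 : ℝ) < x := hx
  rw [Complex.ofReal_ne_zero, sub_ne_zero]
  exact (Real.exp_lt_one_iff.2 (by rw [neg_lt_zero]; positivity)).ne'

lemma two_pi_div_pos (q : ℕ) [NeZero q] : 0 < 2 * Real.pi / q := by
  have hq0 : (0 : ℝ) < q := Nat.cast_pos.2 (Nat.pos_of_ne_zero (NeZero.ne q))
  have hpi := Real.pi_pos
  positivity

lemma mellinConvergent_weight (hq : 1 < q) {χ : DirichletCharacter ℂ q} (hχ : χ ≠ 1) {s : ℂ}
    (hs : 0 < s.re) : MellinConvergent (weight χ) s :=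
  mellinConvergent_of_isBigO_rpow_exp (two_pi_div_pos q) (locallyIntegrableOn_weight χ)
    (weight_isBigO_atTop χ) (weight_isBigO_zero hq hχ) hs

lemma mellin_weight_of_one_lt_re (hq : 1 < q) (χ : DirichletCharacter ℂ q) {s : ℂ}
    (hs : 1 < s.re) : mellin (weight χ) s =
      Complex.Gamma s * ((2 * Real.pi / q : ℝ) : ℂ) ^ (-s) * DirichletCharacter.LFunction χ s := by
  have hc := two_pi_div_pos q
  have hL := DirichletCharacter.LSeriesSummable_of_one_lt_re χ hs
  have hp : ∀ n : ℕ, 2 * Real.pi * n / q = 2 * Real.pi / q * n := fun n => by ring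
  have h1 : HasSum (fun n : ℕ => Complex.Gamma s * χ n / ((2 * Real.pi * n / q : ℝ) : ℂ) ^ s)
      (mellin (weight χ) s) := by
    refine hasSum_mellin (fun n => ?_) (by linarith) (fun x hx => hasSum_weight hq χ hx) ?_
    · rcases Nat.eq_zero_or_pos n with rfl | hn
      · exact .inl (character_zero hq χ)
      · right; rw [hp]; positivity
    · refine (hL.norm.mul_left ((2 * Real.pi / q) ^ s.re)⁻¹).congr fun n => ?_
      rcases Nat.eq_zero_or_pos n with rfl | hn
      · rw [character_zero hq χ]; simp
      · rw [LSeries.norm_term_eq, if_neg hn.ne', hp, Real.mul_rpow hc.le (Nat.cast_nonneg n)]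
        field_simp
  have h2 := hL.hasSum.mul_left (Complex.Gamma s * ((2 * Real.pi / q : ℝ) : ℂ) ^ (-s))
  rw [DirichletCharacter.LFunction_eq_LSeries χ hs]
  refine h1.unique (h2.congr_fun fun n => ?_)
  rcases Nat.eq_zero_or_pos n with rfl | hn
  · rw [character_zero hq χ]; simp
  · rw [LSeries.term_of_ne_zero hn.ne', hp, Complex.ofReal_mul,
      Complex.mul_cpow_ofReal_nonneg hc.le (Nat.cast_nonneg n), Complex.cpow_neg]
    simp only [Complex.ofReal_natCast]
    field_simp

/-- The Mellin transform of the weight, continued from `Re s > 1` to `Re s > 0`. -/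
theorem mellin_weight (hq : 1 < q) {χ : DirichletCharacter ℂ q} (hχ : χ ≠ 1) {s : ℂ}
    (hs : 0 < s.re) : mellin (weight χ) s =
      Complex.Gamma s * ((2 * Real.pi / q : ℝ) : ℂ) ^ (-s) * DirichletCharacter.LFunction χ s := by
  have hopen : IsOpen {s : ℂ | 0 < s.re} := isOpen_lt continuous_const Complex.continuous_re
  have hc : ((2 * Real.pi / q : ℝ) : ℂ) ≠ 0 := Complex.ofReal_ne_zero.2 (two_pi_div_pos q).ne'
  have hf : AnalyticOnNhd ℂ (mellin (weight χ)) {s : ℂ | 0 < s.re} := by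
    refine DifferentiableOn.analyticOnNhd (fun s hs => ?_) hopen
    exact (mellin_differentiableAt_of_isBigO_rpow_exp (two_pi_div_pos q)
      (locallyIntegrableOn_weight χ) (weight_isBigO_atTop χ) (weight_isBigO_zero hq hχ)
      hs).differentiableWithinAt
  have hg : AnalyticOnNhd ℂ (fun s => Complex.Gamma s * ((2 * Real.pi / q : ℝ) : ℂ) ^ (-s) *
      DirichletCharacter.LFunction χ s) {s : ℂ | 0 < s.re} := by
    refine DifferentiableOn.analyticOnNhd (fun s hs => ?_) hopen
    refine DifferentiableAt.differentiableWithinAt ?_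
    refine ((Complex.differentiableAt_Gamma s fun m h => ?_).mul ?_).mul
      (DirichletCharacter.differentiable_LFunction hχ s)
    · have : 0 < s.re := hs
      rw [h] at this
      simp at this
      have h2 : (0 : ℝ) ≤ m := m.cast_nonneg
      linarith
    · exact differentiableAt_id.neg.const_cpow (.inl hc)
  refine hf.eqOn_of_preconnected_of_eventuallyEq hg
    (convex_halfSpace_re_gt 0).isPreconnected (z₀ := 2) (by simp) ?_ hs
  have : {s : ℂ | 1 < s.re} ∈ 𝓝 (2 : ℂ) :=
    (isOpen_lt continuous_const Complex.continuous_re).mem_nhds (by simp)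
  filter_upwards [this] with s hs
  exact mellin_weight_of_one_lt_re hq χ hs

end Weight

/-! ### Integrals over the critical line -/

/-- The quadratic decay on vertical lines makes the Mellin transform of the Gaussian factor
integrable over the critical line. -/
lemma integrable_Gamma_mul_kummer (ν : ℕ) (z : ℂ) :
    Integrable fun y : ℝ => Complex.Gamma ((1 / 2 + y * Complex.I + ν) / 2) *
      kummer ((1 / 2 + y * Complex.I + ν) / 2) (1 / 2 + ν) (z ^ 2 / 4) := by
  have hν0 : (0 : ℝ) ≤ ν := ν.cast_nonneg
  set w : ℝ → ℂ := fun y => (1 / 2 + y * Complex.I + ν) / 2 with hw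
  have hweq : ∀ y, w y = (((1 / 2 + ν) / 2 : ℝ) : ℂ) + ((y / 2 : ℝ) : ℂ) * Complex.I := by
    intro y; simp only [hw]; push_cast; ring
  have hre : ∀ y, (w y).re = (1 / 2 + ν) / 2 := by
    intro y; rw [hweq]; simp
  have him : ∀ y, (w y).im = y / 2 := by
    intro y; rw [hweq]; simp
  have hσ : (0 : ℝ) < (1 / 2 + ν) / 2 := by positivity
  have hwc : Continuous w := by simp only [hw]; fun_prop
  obtain ⟨C, hC⟩ := exists_norm_Gamma_mul_kummer_le (half_le_re_half_add ν) (z ^ 2 / 4) hσ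
  refine Integrable.mono' (integrable_inv_one_add_sq.const_mul (16 * |C|)) ?_ ?_
  · refine AEStronglyMeasurable.mul ?_ ?_
    · refine Continuous.aestronglyMeasurable (continuous_iff_continuousAt.2 fun y => ?_)
      refine ContinuousAt.comp (g := Complex.Gamma) (f := w)
        (Complex.differentiableAt_Gamma _ fun m h => ?_).continuousAt hwc.continuousAt
      have := hre y
      rw [h] at this
      simp at this
      have h2 : (0 : ℝ) ≤ m := m.cast_nonneg
      linarith
    · exact ((measurable_kummer (half_le_re_half_add ν) _).comp
        hwc.measurable).aestronglyMeasurable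
  · refine ae_of_all _ fun y => (hC (w y) (hre y)).trans ?_
    have h1 : (1 + y ^ 2) / 16 ≤ ‖w y‖ ^ 2 := by
      rw [Complex.sq_norm, Complex.normSq_apply, hre, him]
      nlinarith
    have h2 : 0 < (1 + y ^ 2) / 16 := by positivity
    calc C / ‖w y‖ ^ 2 ≤ |C| / ((1 + y ^ 2) / 16) := by
          gcongr
          exact le_abs_self C
      _ = 16 * |C| * (1 + y ^ 2)⁻¹ := by field_simp

lemma integrable_cpow_mul {f : ℝ → ℂ} (hf : Integrable f) {κ : ℝ} (hκ : 0 < κ) :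
    Integrable fun y : ℝ => (κ : ℂ) ^ (-(1 / 2 + y * Complex.I)) * f y := by
  refine hf.bdd_mul (c := κ ^ (-(1 / 2) : ℝ)) ?_ (ae_of_all _ fun y => ?_)
  · refine Continuous.aestronglyMeasurable ?_
    refine Continuous.const_cpow (by fun_prop) (.inl (Complex.ofReal_ne_zero.2 hκ.ne'))
  · rw [Complex.norm_cpow_eq_rpow_re_of_pos hκ]
    refine le_of_eq (congrArg _ ?_)
    simp

variable {q : ℕ} [NeZero q]

lemma integrable_mul_mellin_weight {f : ℝ → ℂ} (hf : Integrable f) (hq : 1 < q)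
    {χ : DirichletCharacter ℂ q} (hχ : χ ≠ 1) :
    Integrable fun y : ℝ => f y * mellin (weight χ) (1 - (1 / 2 + y * Complex.I)) := by
  have hre : ∀ y : ℝ, (1 - (1 / 2 + y * Complex.I)).re = 1 / 2 := by intro y; norm_num
  refine (hf.bdd_mul (f := fun y : ℝ => mellin (weight χ) (1 - (1 / 2 + y * Complex.I)))
    (c := ∫ x in Ioi (0 : ℝ), ‖(x : ℂ) ^ ((1 / 2 : ℂ) - 1) • weight χ x‖) ?_
    (ae_of_all _ fun y => ?_)).congr (ae_of_all _ fun y => mul_comm _ _)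
  · refine Continuous.aestronglyMeasurable (continuous_iff_continuousAt.2 fun y => ?_)
    refine ContinuousAt.comp (g := mellin (weight χ))
      (f := fun y : ℝ => (1 - (1 / 2 + y * Complex.I) : ℂ)) ?_ (by fun_prop)
    exact (mellin_differentiableAt_of_isBigO_rpow_exp (two_pi_div_pos q)
      (locallyIntegrableOn_weight χ) (weight_isBigO_atTop χ) (weight_isBigO_zero hq hχ)
      (by rw [hre]; norm_num)).continuousAt
  · refine (norm_integral_le_integral_norm _).trans (le_of_eq ?_)
    refine setIntegral_congr_fun measurableSet_Ioi fun x hx => ?_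
    simp only [norm_smul, Complex.norm_cpow_eq_rpow_re_of_pos hx]
    congr 2
    norm_num

/-- The integrand on the critical line to which Parseval's formula leads, as a function of the
argument `s` of the `L`-function; `ν = 1` goes with `sinh` and `ν = 0` with `cosh`. -/
noncomputable def lineIntegrand (ν : ℕ) (χ : DirichletCharacter ℂ q) (κ : ℝ) (z s : ℂ) : ℂ :=
  (κ : ℂ) ^ (s - 1) * (Complex.Gamma ((1 - s + ν) / 2) *
    kummer ((1 - s + ν) / 2) (1 / 2 + ν) (z ^ 2 / 4)) *
    (Complex.Gamma s * ((2 * Real.pi / q : ℝ) : ℂ) ^ (-s) * DirichletCharacter.LFunction χ s)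

lemma lineIntegrand_eq (hq : 1 < q) {χ : DirichletCharacter ℂ q} (hχ : χ ≠ 1) (ν : ℕ) (κ : ℝ)
    (z : ℂ) (y : ℝ) : lineIntegrand ν χ κ z (1 - (1 / 2 + y * Complex.I)) =
      (κ : ℂ) ^ (-(1 / 2 + y * Complex.I)) * (Complex.Gamma ((1 / 2 + y * Complex.I + ν) / 2) *
        kummer ((1 / 2 + y * Complex.I + ν) / 2) (1 / 2 + ν) (z ^ 2 / 4)) *
        mellin (weight χ) (1 - (1 / 2 + y * Complex.I)) := by
  rw [lineIntegrand, mellin_weight hq hχ (by norm_num), sub_sub_cancel, sub_sub_cancel_left]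

lemma integrable_lineIntegrand (hq : 1 < q) {χ : DirichletCharacter ℂ q} (hχ : χ ≠ 1) (ν : ℕ)
    {κ : ℝ} (hκ : 0 < κ) (z : ℂ) :
    Integrable fun y : ℝ => lineIntegrand ν χ κ z (1 - (1 / 2 + y * Complex.I)) := by
  simp_rw [lineIntegrand_eq hq hχ]
  exact integrable_mul_mellin_weight
    (integrable_cpow_mul (integrable_Gamma_mul_kummer ν z) hκ) hq hχ

lemma integrableOn_gaussMul_mul_weight (hq : 1 < q) {χ : DirichletCharacter ℂ q} (hχ : χ ≠ 1)
    {h : ℂ → ℂ} (hcont : Continuous h) (hbd : ∀ w, ‖h w‖ ≤ Real.exp ‖w‖) {κ : ℝ} (hκ : 0 < κ)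
    (z : ℂ) : IntegrableOn (fun x => gaussMul h z (κ * x) * weight χ x) (Ioi 0) := by
  have h1 := mellinConvergent_weight hq hχ (s := 1) (by simp)
  have h2 : IntegrableOn (weight χ) (Ioi 0) := by simpa [MellinConvergent] using h1
  refine Integrable.bdd_mul (c := Real.exp ((‖z‖ + 1) ^ 2 / 4)) h2 ?_ ?_
  · exact ((continuous_gaussMul hcont z).comp (continuous_const_mul κ)).aestronglyMeasurable
  · filter_upwards [ae_restrict_mem measurableSet_Ioi] with x hx
    have hx0 : (0 : ℝ) < x := hx
    refine (norm_gaussMul_le hbd z (by positivity)).trans ?_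
    refine mul_le_of_le_one_right (Real.exp_pos _).le (Real.exp_le_one_iff.2 ?_)
    nlinarith [mul_pos hκ hx0]

/-- Parseval's formula on the critical line for the Gaussian factor and the weight. -/
theorem integral_gaussMul_mul_weight (hq : 1 < q) {χ : DirichletCharacter ℂ q} (hχ : χ ≠ 1)
    {ν : ℕ} (hν : ν = 0 ∨ ν = 1) {h : ℂ → ℂ} (hcont : Continuous h)
    (hbd : ∀ w, ‖h w‖ ≤ Real.exp ‖w‖)
    (hh : ∀ w, HasSum (fun k : ℕ => w ^ (2 * k + ν) / ((2 * k + ν).factorial : ℂ)) (h w))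
    {κ : ℝ} (hκ : 0 < κ) (z : ℂ) :
    ∫ x in Ioi (0 : ℝ), gaussMul h z (κ * x) * weight χ x = z ^ ν / (4 * Real.pi) *
      ∫ y : ℝ, lineIntegrand ν χ κ z (1 - (1 / 2 + y * Complex.I)) := by
  have hM : ∀ y : ℝ, mellin (fun x => gaussMul h z (κ * x)) (1 / 2 + y * Complex.I) =
      z ^ ν / 2 * ((κ : ℂ) ^ (-(1 / 2 + y * Complex.I)) *
        (Complex.Gamma ((1 / 2 + y * Complex.I + ν) / 2) *
        kummer ((1 / 2 + y * Complex.I + ν) / 2) (1 / 2 + ν) (z ^ 2 / 4))) := by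
    intro y
    rw [mellin_comp_mul_left _ _ hκ, mellin_gaussMul hν hh z (by norm_num), smul_eq_mul]
    ring
  have hσ : (((1 / 2 : ℝ)) : ℂ) = 1 / 2 := by norm_num
  have hP := integral_mul_eq_integral_mellin (f := fun x => gaussMul h z (κ * x)) (W := weight χ)
    (σ := 1 / 2) ((continuous_gaussMul hcont z).comp (continuous_const_mul κ)).continuousOn
    ((MellinConvergent.comp_mul_left hκ).2
      (mellinConvergent_gaussMul hcont hbd z (by norm_num))) ?_
    (mellinConvergent_weight hq hχ (by norm_num))
  · rw [hP, hσ]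
    simp_rw [hM, lineIntegrand_eq hq hχ, mul_assoc (z ^ ν / 2)]
    rw [integral_const_mul, ← mul_assoc]
    congr 1
    ring
  · rw [Complex.VerticalIntegrable, hσ]
    simp_rw [hM]
    exact (integrable_cpow_mul (integrable_Gamma_mul_kummer ν z) hκ).const_mul _

/-- Folding an integral over the line to the half-line, with the substitution `y = ± t / 2`. -/
lemma integral_eq_half_integral_Ioi {g : ℝ → ℂ} (hg : Integrable g) :
    IntegrableOn (fun t => g (-(t / 2)) + g (t / 2)) (Ioi 0) ∧
      ∫ y, g y = 1 / 2 * ∫ t in Ioi (0 : ℝ), (g (-(t / 2)) + g (t / 2)) := by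
  have h1 : Integrable fun t => g (t / 2) := hg.comp_div two_ne_zero
  have h2 : Integrable fun t => g (-(t / 2)) := by
    simpa [neg_div] using h1.comp_neg
  refine ⟨(h2.add h1).integrableOn, ?_⟩
  rw [integral_add h2.integrableOn h1.integrableOn]
  have h3 := integral_comp_neg_Ioi 0 fun t => g (t / 2)
  simp only [neg_div, neg_zero] at h3
  rw [h3, intervalIntegral.integral_Iic_add_Ioi h1.integrableOn h1.integrableOn,
    Measure.integral_comp_div, abs_two, Complex.real_smul]
  push_cast
  ring

/-- Up to a power of `q`, `ξ` is the completed `L`-function. The condition `0 < Re s` avoids the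
poles of the gamma factor, where the quotient by it is a junk value. -/
lemma xi_eq (hq : 1 < q) (χ : DirichletCharacter ℂ q) {s : ℂ} (hs : 0 < s.re) :
    xi χ s = (q : ℂ) ^ ((s + parity χ) / 2) * DirichletCharacter.completedLFunction χ s := by
  have hqr : (0 : ℝ) < q := by exact_mod_cast (by omega : 0 < q)
  have hL := DirichletCharacter.LFunction_eq_completed_div_gammaFactor χ s (.inr hq.ne')
  have hγ : χ.gammaFactor s = Complex.Gammaℝ (s + parity χ) := by
    rw [parity]
    split_ifs with he
    · rw [he.gammaFactor_def, add_zero]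
    · rw [(χ.even_or_odd.resolve_left he).gammaFactor_def]
  have hp : 0 ≤ (parity χ).re := by rw [parity]; split_ifs <;> simp
  have h0 : Complex.Gammaℝ (s + parity χ) ≠ 0 :=
    Complex.Gammaℝ_ne_zero_of_re_pos (by rw [Complex.add_re]; linarith)
  rw [hγ, eq_div_iff h0] at hL
  rw [← hL, Complex.Gammaℝ_def, xi, div_eq_mul_inv Real.pi, Complex.ofReal_mul,
    Complex.mul_cpow_ofReal_nonneg Real.pi_pos.le (by positivity)]
  have : (((q : ℝ)⁻¹ : ℝ) : ℂ) ^ (-(s + parity χ) / 2) = (q : ℂ) ^ ((s + parity χ) / 2) := by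
    rw [Complex.ofReal_inv, Complex.ofReal_natCast, Complex.inv_cpow _ _ (by
      rw [Complex.natCast_arg]; exact Real.pi_pos.ne), ← Complex.cpow_neg]
    congr 1
    ring
  rw [this]
  ring

/-- The functional equation; its sign is `+1` because the root number of a primitive quadratic
character is `1`. -/
theorem xi_one_sub (hq : 1 < q) {χ : DirichletCharacter ℂ q} (hχ : χ.IsQuadratic)
    (hprim : χ.IsPrimitive) {s : ℂ} (hs : 0 < s.re) (hs1 : s.re < 1) : xi χ (1 - s) = xi χ s := by
  have hq0 : (q : ℂ) ≠ 0 := Nat.cast_ne_zero.2 (NeZero.ne q)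
  rw [xi_eq hq χ (by simpa using hs1), xi_eq hq χ hs, hprim.completedLFunction_one_sub,
    DirichletCharacter.rootNumber_eq_one hχ hprim, hχ.inv, mul_one, ← mul_assoc,
    ← Complex.cpow_add _ _ hq0]
  congr 2
  ring

lemma ofReal_cpow_eq_exp {r : ℝ} (hr : 0 < r) (w : ℂ) :
    (r : ℂ) ^ w = Complex.exp (Real.log r * w) := by
  rw [Complex.cpow_def_of_ne_zero (Complex.ofReal_ne_zero.2 hr.ne'), Complex.ofReal_log hr.le]

lemma ofReal_sqrt_eq_exp {r : ℝ} (hr : 0 < r) :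
    (Real.sqrt r : ℂ) = Complex.exp (Real.log r * (1 / 2)) := by
  rw [Real.sqrt_eq_rpow, Complex.ofReal_cpow hr.le, ofReal_cpow_eq_exp hr]
  push_cast
  rfl

/-- The elementary factors on the critical line, after the duplication formula for `Γ(s)`. -/
lemma sqrt_mul_cpow_mul_Gamma {α β : ℝ} (hα : 0 < α) (hβ : 0 < β) (hαβ : α * β = 1) (s : ℂ) :
    (Real.sqrt β : ℂ) * ((Real.sqrt Real.pi * β / Real.sqrt q : ℝ) : ℂ) ^ (s - 1) *
      (Complex.Gamma s * ((2 * Real.pi / q : ℝ) : ℂ) ^ (-s)) =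
    1 / (2 * (Real.sqrt Real.pi : ℂ)) * ((α : ℂ) ^ (1 / 2 - s) *
      ((Real.pi / q : ℝ) : ℂ) ^ (-(s + 1) / 2) *
      (Complex.Gamma (s / 2) * Complex.Gamma ((s + 1) / 2))) := by
  have hqr : (0 : ℝ) < q := Nat.cast_pos.2 (Nat.pos_of_ne_zero (NeZero.ne q))
  have hpi := Real.pi_pos
  have hsp : 0 < Real.sqrt Real.pi := Real.sqrt_pos.2 hpi
  have hsq : 0 < Real.sqrt q := Real.sqrt_pos.2 hqr
  have hdup := Complex.Gamma_mul_Gamma_add_half (s / 2)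
  rw [show s / 2 + 1 / 2 = (s + 1) / 2 by ring, show 2 * (s / 2) = s by ring] at hdup
  have hspc : (Real.sqrt Real.pi : ℂ) ≠ 0 := Complex.ofReal_ne_zero.2 hsp.ne'
  have hlα : Real.log α = -Real.log β := by
    rw [eq_neg_iff_add_eq_zero, ← Real.log_mul hα.ne' hβ.ne', hαβ, Real.log_one]
  have h2 : (2 : ℂ) ^ (1 - s) = Complex.exp (Real.log 2 * (1 - s)) := by
    rw [← ofReal_cpow_eq_exp two_pos]; norm_num
  rw [hdup, h2]
  have key : (Real.sqrt β : ℂ) * ((Real.sqrt Real.pi * β / Real.sqrt q : ℝ) : ℂ) ^ (s - 1) *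
      ((2 * Real.pi / q : ℝ) : ℂ) ^ (-s) * 2 = (α : ℂ) ^ (1 / 2 - s) *
      ((Real.pi / q : ℝ) : ℂ) ^ (-(s + 1) / 2) * Complex.exp (Real.log 2 * (1 - s)) := by
    have h2' : (2 : ℂ) = Complex.exp (Real.log 2) := by
      rw [← Complex.ofReal_exp, Real.exp_log two_pos]; norm_num
    rw [show ∀ a : ℂ, a * 2 = a * Complex.exp (Real.log 2) from fun a => by rw [← h2'],
      ofReal_sqrt_eq_exp hβ, ofReal_cpow_eq_exp (by positivity), ofReal_cpow_eq_exp (by positivity),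
      ofReal_cpow_eq_exp hα, ofReal_cpow_eq_exp (by positivity)]
    simp only [← Complex.exp_add]
    congr 1
    rw [Real.log_div (by positivity) hsq.ne', Real.log_mul hsp.ne' hβ.ne', Real.log_sqrt hpi.le,
      Real.log_sqrt hqr.le, Real.log_div (by positivity) hqr.ne', Real.log_mul two_ne_zero hpi.ne',
      Real.log_div hpi.ne' hqr.ne', hlα]
    push_cast
    ring
  have hS : 1 / (2 * (Real.sqrt Real.pi : ℂ)) * (Real.sqrt Real.pi : ℂ) = 1 / 2 := by field_simp
  linear_combination (Complex.Gamma s / 2) * key - ((α : ℂ) ^ (1 / 2 - s) *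
    ((Real.pi / q : ℝ) : ℂ) ^ (-(s + 1) / 2) * Complex.exp (Real.log 2 * (1 - s)) *
    Complex.Gamma s) * hS

/-- Kummer's transformation, read as invariance under `(x, z, s) ↦ (1/x, iz, 1 - s)`. -/
lemma omega_symm {α β : ℝ} (hα : 0 < α) (hβ : 0 < β) (hαβ : α * β = 1) (z s : ℂ) :
    omega β (z * Complex.I) (1 - s) = omega α z s := by
  have hlα : Real.log α = -Real.log β := by
    rw [eq_neg_iff_add_eq_zero, ← Real.log_mul hα.ne' hβ.ne', hαβ, Real.log_one]
  have hc : 1 / 2 ≤ (3 / 2 : ℂ).re := by norm_num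
  rw [omega, omega, ofReal_cpow_eq_exp hα, ofReal_cpow_eq_exp hβ,
    kummer_eq_exp_mul_kummer (1 - s / 2) (z ^ 2 / 4) hc, hlα, mul_pow, Complex.I_sq,
    ← mul_assoc _ (Complex.exp (z ^ 2 / 4)),
    ← Complex.exp_add, ← Complex.exp_add, ← Complex.exp_add]
  congr 2
  · push_cast; ring
  · ring
  · ring

/-- Kummer's transformation, read as invariance under `(x, z, s) ↦ (1/x, iz, 1 - s)`. -/
lemma rho_symm {α β : ℝ} (hα : 0 < α) (hβ : 0 < β) (hαβ : α * β = 1) (z s : ℂ) :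
    rho β (z * Complex.I) (1 - s) = rho α z s := by
  have hlα : Real.log α = -Real.log β := by
    rw [eq_neg_iff_add_eq_zero, ← Real.log_mul hα.ne' hβ.ne', hαβ, Real.log_one]
  have hc : 1 / 2 ≤ (1 / 2 : ℂ).re := by norm_num
  rw [rho, rho, ofReal_cpow_eq_exp hα, ofReal_cpow_eq_exp hβ,
    kummer_eq_exp_mul_kummer ((1 - s) / 2) (z ^ 2 / 4) hc, hlα, mul_pow, Complex.I_sq,
    ← mul_assoc _ (Complex.exp (z ^ 2 / 4)),
    ← Complex.exp_add, ← Complex.exp_add, ← Complex.exp_add]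
  congr 2
  · push_cast; ring
  · ring
  · ring

lemma Delta_symm {α β : ℝ} (hα : 0 < α) (hβ : 0 < β) (hαβ : α * β = 1) (z s : ℂ) :
    Delta β (z * Complex.I) s = Delta α z s := by
  have h := omega_symm hα hβ hαβ z (1 - s)
  rw [sub_sub_cancel] at h
  rw [Delta, Delta, h, omega_symm hα hβ hαβ, add_comm]

lemma Nabla_symm {α β : ℝ} (hα : 0 < α) (hβ : 0 < β) (hαβ : α * β = 1) (z s : ℂ) :
    Nabla β (z * Complex.I) s = Nabla α z s := by
  have h := rho_symm hα hβ hαβ z (1 - s)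
  rw [sub_sub_cancel] at h
  rw [Nabla, Nabla, h, rho_symm hα hβ hαβ, add_comm]

lemma gaussIntegrand_eq_gaussMul {q : ℕ} (χ : DirichletCharacter ℂ q) (g : ℂ → ℂ)
    (β : ℝ) (z : ℂ) (x : ℝ) :
    gaussIntegrand χ g β z x =
      gaussMul g z (Real.sqrt Real.pi * β / Real.sqrt q * x) * weight χ x := by
  have hqr : (0 : ℝ) ≤ q := Nat.cast_nonneg q
  rw [gaussIntegrand, gaussMul]
  congr 2
  · rw [Complex.ofReal_exp]
    congr 1
    rw [← Complex.ofReal_pow, ← Complex.ofReal_neg]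
    congr 1
    rw [mul_pow, div_pow, mul_pow, Real.sq_sqrt Real.pi_pos.le, Real.sq_sqrt hqr]
    ring
  · congr 1
    push_cast
    ring

/-! ### Integral representations in terms of `Ξ` -/

/-- The integrand on the critical line in terms of `ξ` and `ω`, for an even character. -/
lemma lineIntegrand_one_eq {χ : DirichletCharacter ℂ q} (he : χ.Even) {α β : ℝ} (hα : 0 < α)
    (hβ : 0 < β) (hαβ : α * β = 1) (z s : ℂ) :
    (Real.sqrt β : ℂ) * Complex.exp (-z ^ 2 / 8) *
      lineIntegrand 1 χ (Real.sqrt Real.pi * β / Real.sqrt q) z s =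
    (Real.sqrt q : ℂ) / (2 * Real.pi) * (Complex.Gamma ((s + 1) / 2) * Complex.Gamma (1 - s / 2) *
      xi χ s * omega α z s) := by
  have hqr : (0 : ℝ) < q := Nat.cast_pos.2 (Nat.pos_of_ne_zero (NeZero.ne q))
  have hpi := Real.pi_pos
  have h := sqrt_mul_cpow_mul_Gamma (q := q) hα hβ hαβ s
  -- for even `χ` the shift in the exponent of `π / q` costs a factor `√(q / π)`
  have hr : ((Real.pi / q : ℝ) : ℂ) ^ (-(s + 1) / 2) =
      (Real.sqrt q : ℂ) / (Real.sqrt Real.pi : ℂ) * ((Real.pi / q : ℝ) : ℂ) ^ (-s / 2) := by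
    have e1 : (Real.sqrt q : ℂ) / (Real.sqrt Real.pi : ℂ) =
        Complex.exp (Real.log (Real.pi / q) * (-1 / 2)) := by
      rw [ofReal_sqrt_eq_exp hqr, ofReal_sqrt_eq_exp hpi, ← Complex.exp_sub,
        Real.log_div hpi.ne' hqr.ne']
      congr 1
      push_cast
      ring
    rw [e1, ofReal_cpow_eq_exp (by positivity), ofReal_cpow_eq_exp (by positivity),
      ← Complex.exp_add]
    congr 1
    ring
  have hs : 1 / (2 * (Real.sqrt Real.pi : ℂ)) * ((Real.sqrt q : ℂ) / (Real.sqrt Real.pi : ℂ)) =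
      (Real.sqrt q : ℂ) / (2 * Real.pi) := by
    have h1 : (Real.sqrt Real.pi : ℂ) * (Real.sqrt Real.pi : ℂ) = Real.pi := by
      rw [← Complex.ofReal_mul, Real.mul_self_sqrt hpi.le]
    rw [div_mul_div_comm, one_mul, mul_assoc, h1]
  rw [lineIntegrand, xi, omega, parity, if_pos he, add_zero, Nat.cast_one,
    show (1 - s + 1) / 2 = 1 - s / 2 by ring, show (1 / 2 + 1 : ℂ) = 3 / 2 by norm_num]
  rw [hr] at h
  linear_combination (Complex.exp (-z ^ 2 / 8) * Complex.Gamma (1 - s / 2) *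
    kummer (1 - s / 2) (3 / 2) (z ^ 2 / 4) * DirichletCharacter.LFunction χ s) * h +
    (Complex.exp (-z ^ 2 / 8) * Complex.Gamma (1 - s / 2) *
    kummer (1 - s / 2) (3 / 2) (z ^ 2 / 4) * DirichletCharacter.LFunction χ s *
    (α : ℂ) ^ (1 / 2 - s) * ((Real.pi / q : ℝ) : ℂ) ^ (-s / 2) *
      (Complex.Gamma (s / 2) * Complex.Gamma ((s + 1) / 2))) * hs

/-- The integrand on the critical line in terms of `ξ` and `ρ`, for an odd character. -/
lemma lineIntegrand_zero_eq {χ : DirichletCharacter ℂ q} (ho : χ.Odd) {α β : ℝ} (hα : 0 < α)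
    (hβ : 0 < β) (hαβ : α * β = 1) (z s : ℂ) :
    (Real.sqrt β : ℂ) * Complex.exp (-z ^ 2 / 8) *
      lineIntegrand 0 χ (Real.sqrt Real.pi * β / Real.sqrt q) z s =
    1 / (2 * (Real.sqrt Real.pi : ℂ)) * (Complex.Gamma (s / 2) * Complex.Gamma ((1 - s) / 2) *
      xi χ s * rho α z s) := by
  have h := sqrt_mul_cpow_mul_Gamma (q := q) hα hβ hαβ s
  rw [lineIntegrand, xi, rho, parity, if_neg ho.not_even, Nat.cast_zero, add_zero, add_zero]
  linear_combination (Complex.exp (-z ^ 2 / 8) * Complex.Gamma ((1 - s) / 2) *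
    kummer ((1 - s) / 2) (1 / 2) (z ^ 2 / 4) * DirichletCharacter.LFunction χ s) * h

/-- The two terms of `Δ` are the values of the integrand at `s` and `1 - s`, where
`s = (1 + it)/2`, because `ξ(1 - s) = ξ(s)`. -/
lemma evenXiIntegrand_eq (hq : 1 < q) {χ : DirichletCharacter ℂ q} (hχ : χ.IsQuadratic)
    (hprim : χ.IsPrimitive) (he : χ.Even) {α β : ℝ} (hα : 0 < α)
    (hβ : 0 < β) (hαβ : α * β = 1) (z : ℂ) (t : ℝ) :
    evenXiIntegrand χ α z t = (2 * Real.pi) / (Real.sqrt q : ℂ) *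
      ((Real.sqrt β : ℂ) * Complex.exp (-z ^ 2 / 8)) *
      (lineIntegrand 1 χ (Real.sqrt Real.pi * β / Real.sqrt q) z
          (1 - (1 / 2 + ((-(t / 2) : ℝ) : ℂ) * Complex.I)) +
        lineIntegrand 1 χ (Real.sqrt Real.pi * β / Real.sqrt q) z
          (1 - (1 / 2 + ((t / 2 : ℝ) : ℂ) * Complex.I))) := by
  have hqr : (0 : ℝ) < q := Nat.cast_pos.2 (Nat.pos_of_ne_zero (NeZero.ne q))
  have hsq : (Real.sqrt q : ℂ) ≠ 0 := Complex.ofReal_ne_zero.2 (Real.sqrt_pos.2 hqr).ne'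
  have hpi : (Real.pi : ℂ) ≠ 0 := Complex.ofReal_ne_zero.2 Real.pi_pos.ne'
  set s : ℂ := 1 / 2 + ((t / 2 : ℝ) : ℂ) * Complex.I with hs
  have hre : s.re = 1 / 2 := by rw [hs]; norm_num
  have h1 := lineIntegrand_one_eq he hα hβ hαβ z s
  have h2 := lineIntegrand_one_eq he hα hβ hαβ z (1 - s)
  rw [xi_one_sub hq hχ hprim (by rw [hre]; norm_num) (by rw [hre]; norm_num)] at h2
  rw [show 1 - (1 / 2 + ((-(t / 2) : ℝ) : ℂ) * Complex.I) = s by rw [hs]; push_cast; ring,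
    mul_assoc, mul_add, h1, h2, evenXiIntegrand, Delta, Xi,
    show (1 + Complex.I * t) / 2 = s by rw [hs]; push_cast; ring,
    show 1 / 2 + Complex.I * (t / 2) = s by rw [hs]; push_cast; ring,
    show (3 + Complex.I * t) / 4 = (s + 1) / 2 by rw [hs]; push_cast; ring,
    show (3 - Complex.I * t) / 4 = 1 - s / 2 by rw [hs]; push_cast; ring,
    show (1 - s + 1) / 2 = 1 - s / 2 by ring, show 1 - (1 - s) / 2 = (s + 1) / 2 by ring]
  field_simp

/-- The two terms of `∇` are the values of the integrand at `s` and `1 - s`, where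
`s = (1 + it)/2`, because `ξ(1 - s) = ξ(s)`. -/
lemma oddXiIntegrand_eq (hq : 1 < q) {χ : DirichletCharacter ℂ q} (hχ : χ.IsQuadratic)
    (hprim : χ.IsPrimitive) (ho : χ.Odd) {α β : ℝ} (hα : 0 < α)
    (hβ : 0 < β) (hαβ : α * β = 1) (z : ℂ) (t : ℝ) :
    oddXiIntegrand χ α z t = (2 * (Real.sqrt Real.pi : ℂ)) *
      ((Real.sqrt β : ℂ) * Complex.exp (-z ^ 2 / 8)) *
      (lineIntegrand 0 χ (Real.sqrt Real.pi * β / Real.sqrt q) z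
          (1 - (1 / 2 + ((-(t / 2) : ℝ) : ℂ) * Complex.I)) +
        lineIntegrand 0 χ (Real.sqrt Real.pi * β / Real.sqrt q) z
          (1 - (1 / 2 + ((t / 2 : ℝ) : ℂ) * Complex.I))) := by
  have hpi : (Real.sqrt Real.pi : ℂ) ≠ 0 :=
    Complex.ofReal_ne_zero.2 (Real.sqrt_pos.2 Real.pi_pos).ne'
  set s : ℂ := 1 / 2 + ((t / 2 : ℝ) : ℂ) * Complex.I with hs
  have hre : s.re = 1 / 2 := by rw [hs]; norm_num
  have h1 := lineIntegrand_zero_eq ho hα hβ hαβ z s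
  have h2 := lineIntegrand_zero_eq ho hα hβ hαβ z (1 - s)
  rw [xi_one_sub hq hχ hprim (by rw [hre]; norm_num) (by rw [hre]; norm_num)] at h2
  rw [show 1 - (1 / 2 + ((-(t / 2) : ℝ) : ℂ) * Complex.I) = s by rw [hs]; push_cast; ring,
    mul_assoc, mul_add, h1, h2, oddXiIntegrand, Nabla, Xi,
    show (1 + Complex.I * t) / 2 = s by rw [hs]; push_cast; ring,
    show 1 / 2 + Complex.I * (t / 2) = s by rw [hs]; push_cast; ring,
    show (1 + Complex.I * t) / 4 = s / 2 by rw [hs]; push_cast; ring,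
    show (1 - Complex.I * t) / 4 = (1 - s) / 2 by rw [hs]; push_cast; ring, sub_sub_cancel]
  field_simp

lemma norm_sinh_le (w : ℂ) : ‖Complex.sinh w‖ ≤ Real.exp ‖w‖ := by
  rw [Complex.sinh, norm_div, Complex.norm_ofNat, div_le_iff₀ two_pos]
  have h1 := Complex.norm_exp_le_exp_norm w
  have h2 := Complex.norm_exp_le_exp_norm (-w)
  rw [norm_neg] at h2
  linarith [norm_sub_le (Complex.exp w) (Complex.exp (-w))]

lemma norm_cosh_le (w : ℂ) : ‖Complex.cosh w‖ ≤ Real.exp ‖w‖ := by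
  rw [Complex.cosh, norm_div, Complex.norm_ofNat, div_le_iff₀ two_pos]
  have h1 := Complex.norm_exp_le_exp_norm w
  have h2 := Complex.norm_exp_le_exp_norm (-w)
  rw [norm_neg] at h2
  linarith [norm_add_le (Complex.exp w) (Complex.exp (-w))]

lemma sqrt_pi_mul_div_pos (q : ℕ) [NeZero q] {β : ℝ} (hβ : 0 < β) :
    0 < Real.sqrt Real.pi * β / Real.sqrt q := by
  have hqr : (0 : ℝ) < q := Nat.cast_pos.2 (Nat.pos_of_ne_zero (NeZero.ne q))
  have := Real.pi_pos
  positivity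

/-- The `sinh` integral as an integral over the critical line, with absolute convergence. -/
theorem integral_sinh_eq (hq : 1 < q) {χ : DirichletCharacter ℂ q} (hχ : χ.IsQuadratic)
    (hprim : χ.IsPrimitive) (he : χ.Even) {α β : ℝ} (hα : 0 < α)
    (hβ : 0 < β) (hαβ : α * β = 1) (z : ℂ) :
    IntegrableOn (gaussIntegrand χ Complex.sinh β z) (Ioi 0) ∧
    IntegrableOn (evenXiIntegrand χ α z) (Ioi 0) ∧
    (Real.sqrt β : ℂ) * Complex.exp (-z ^ 2 / 8) *
        ∫ x in Ioi (0 : ℝ), gaussIntegrand χ Complex.sinh β z x =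
      z * (Real.sqrt q : ℂ) / (16 * (Real.pi : ℂ) ^ 2) *
        ∫ t in Ioi (0 : ℝ), evenXiIntegrand χ α z t := by
  have h1 := DirichletCharacter.ne_one_of_isPrimitive hq.ne' hprim
  have hκ := sqrt_pi_mul_div_pos q hβ
  have hqr : (0 : ℝ) < q := Nat.cast_pos.2 (Nat.pos_of_ne_zero (NeZero.ne q))
  have hsq : (Real.sqrt q : ℂ) ≠ 0 := Complex.ofReal_ne_zero.2 (Real.sqrt_pos.2 hqr).ne'
  have hpi : (Real.pi : ℂ) ≠ 0 := Complex.ofReal_ne_zero.2 Real.pi_pos.ne'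
  obtain ⟨hI, hE⟩ := integral_eq_half_integral_Ioi (integrable_lineIntegrand hq h1 1 hκ z)
  have hX := evenXiIntegrand_eq hq hχ hprim he hα hβ hαβ z
  refine ⟨?_, ?_, ?_⟩
  · exact (integrableOn_gaussMul_mul_weight hq h1 Complex.continuous_sinh norm_sinh_le hκ
      z).congr_fun
      (fun x _ => (gaussIntegrand_eq_gaussMul χ _ β z x).symm) measurableSet_Ioi
  · exact (Integrable.const_mul hI _).congr (ae_of_all _ fun t => (hX t).symm)
  · simp_rw [gaussIntegrand_eq_gaussMul, hX]
    rw [integral_gaussMul_mul_weight hq h1 (.inr rfl) Complex.continuous_sinh norm_sinh_le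
      Complex.hasSum_sinh hκ, hE, integral_const_mul]
    generalize (∫ t in Ioi (0 : ℝ), (_ : ℂ)) = J
    field_simp
    ring

/-- The `cosh` integral as an integral over the critical line, with absolute convergence. -/
theorem integral_cosh_eq (hq : 1 < q) {χ : DirichletCharacter ℂ q} (hχ : χ.IsQuadratic)
    (hprim : χ.IsPrimitive) (ho : χ.Odd) {α β : ℝ} (hα : 0 < α)
    (hβ : 0 < β) (hαβ : α * β = 1) (z : ℂ) :
    IntegrableOn (gaussIntegrand χ Complex.cosh β z) (Ioi 0) ∧
    IntegrableOn (oddXiIntegrand χ α z) (Ioi 0) ∧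
    (Real.sqrt β : ℂ) * Complex.exp (-z ^ 2 / 8) *
        ∫ x in Ioi (0 : ℝ), gaussIntegrand χ Complex.cosh β z x =
      1 / (16 * ((Real.pi ^ (3 / 2 : ℝ) : ℝ) : ℂ)) *
        ∫ t in Ioi (0 : ℝ), oddXiIntegrand χ α z t := by
  have h1 := DirichletCharacter.ne_one_of_isPrimitive hq.ne' hprim
  have hκ := sqrt_pi_mul_div_pos q hβ
  have hpi0 := Real.pi_pos
  have hpi : (Real.pi : ℂ) ≠ 0 := Complex.ofReal_ne_zero.2 Real.pi_pos.ne'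
  have hsp : (Real.sqrt Real.pi : ℂ) ≠ 0 :=
    Complex.ofReal_ne_zero.2 (Real.sqrt_pos.2 Real.pi_pos).ne'
  have h32 : ((Real.pi ^ (3 / 2 : ℝ) : ℝ) : ℂ) = Real.pi * (Real.sqrt Real.pi : ℂ) := by
    rw [← Complex.ofReal_mul, Real.sqrt_eq_rpow, show (3 / 2 : ℝ) = 1 + 1 / 2 by norm_num,
      Real.rpow_add hpi0, Real.rpow_one]
  obtain ⟨hI, hE⟩ := integral_eq_half_integral_Ioi (integrable_lineIntegrand hq h1 0 hκ z)
  have hX := oddXiIntegrand_eq hq hχ hprim ho hα hβ hαβ z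
  refine ⟨?_, ?_, ?_⟩
  · exact (integrableOn_gaussMul_mul_weight hq h1 Complex.continuous_cosh norm_cosh_le hκ
      z).congr_fun
      (fun x _ => (gaussIntegrand_eq_gaussMul χ _ β z x).symm) measurableSet_Ioi
  · exact (Integrable.const_mul hI _).congr (ae_of_all _ fun t => (hX t).symm)
  · simp_rw [gaussIntegrand_eq_gaussMul, hX]
    rw [integral_gaussMul_mul_weight hq h1 (.inl rfl) Complex.continuous_cosh norm_cosh_le
      Complex.hasSum_cosh hκ, hE, integral_const_mul, h32]
    generalize (∫ t in Ioi (0 : ℝ), (_ : ℂ)) = J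
    field_simp
    ring

lemma gaussIntegrand_sinh_mul_I {q : ℕ} (χ : DirichletCharacter ℂ q) (α : ℝ) (z : ℂ) (x : ℝ) :
    gaussIntegrand χ Complex.sinh α (z * Complex.I) x =
      Complex.I * gaussIntegrand χ Complex.sin α z x := by
  rw [gaussIntegrand, gaussIntegrand, ← mul_assoc, mul_div_right_comm, Complex.sinh_mul_I]
  ring

lemma gaussIntegrand_cosh_mul_I {q : ℕ} (χ : DirichletCharacter ℂ q) (α : ℝ) (z : ℂ) (x : ℝ) :
    gaussIntegrand χ Complex.cosh α (z * Complex.I) x = gaussIntegrand χ Complex.cos α z x := by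
  rw [gaussIntegrand, gaussIntegrand, ← mul_assoc, mul_div_right_comm, Complex.cosh_mul_I]

lemma isQuadratic_of_im_eq_zero {χ : DirichletCharacter ℂ q} (h : ∀ a : ZMod q, (χ a).im = 0) :
    χ.IsQuadratic := by
  intro a
  by_cases ha : IsUnit a
  · right
    have h1 : ‖χ a‖ = 1 := χ.unit_norm_eq_one ha.unit
    have h2 : χ a = ((χ a).re : ℂ) := Complex.ext rfl (by simp [h a])
    rw [h2, Complex.norm_real, Real.norm_eq_abs] at h1
    rcases eq_or_eq_neg_of_abs_eq h1 with h3 | h3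
    · left; rw [h2, h3, Complex.ofReal_one]
    · right; rw [h2, h3, Complex.ofReal_neg, Complex.ofReal_one]
  · exact .inl (χ.map_nonunit ha)

end CharXi

theorem theorem1p3 (q : ℕ) [NeZero q] (hq : 1 < q) (χ : DirichletCharacter ℂ q)
    (hprim : χ.IsPrimitive) (hreal : ∀ a : ZMod q, (χ a).im = 0)
    (z : ℂ) (α β : ℝ) (hα : 0 < α) (hβ : 0 < β) (hαβ : α * β = 1) :
    (χ.Even →
      IntegrableOn (CharXi.gaussIntegrand χ Complex.sin α z) (Ioi 0) ∧
      IntegrableOn (CharXi.gaussIntegrand χ Complex.sinh β z) (Ioi 0) ∧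
      IntegrableOn (CharXi.evenXiIntegrand χ α z) (Ioi 0) ∧
      (Real.sqrt α : ℂ) * Complex.exp (z ^ 2 / 8) *
          ∫ x in Ioi (0 : ℝ), CharXi.gaussIntegrand χ Complex.sin α z x =
        (Real.sqrt β : ℂ) * Complex.exp (-z ^ 2 / 8) *
          ∫ x in Ioi (0 : ℝ), CharXi.gaussIntegrand χ Complex.sinh β z x ∧
      (Real.sqrt β : ℂ) * Complex.exp (-z ^ 2 / 8) *
          ∫ x in Ioi (0 : ℝ), CharXi.gaussIntegrand χ Complex.sinh β z x =
        z * (Real.sqrt q : ℂ) / (16 * (Real.pi : ℂ) ^ 2) *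
          ∫ t in Ioi (0 : ℝ), CharXi.evenXiIntegrand χ α z t) ∧
    (χ.Odd →
      IntegrableOn (CharXi.gaussIntegrand χ Complex.cos α z) (Ioi 0) ∧
      IntegrableOn (CharXi.gaussIntegrand χ Complex.cosh β z) (Ioi 0) ∧
      IntegrableOn (CharXi.oddXiIntegrand χ α z) (Ioi 0) ∧
      (Real.sqrt α : ℂ) * Complex.exp (z ^ 2 / 8) *
          ∫ x in Ioi (0 : ℝ), CharXi.gaussIntegrand χ Complex.cos α z x =
        (Real.sqrt β : ℂ) * Complex.exp (-z ^ 2 / 8) *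
          ∫ x in Ioi (0 : ℝ), CharXi.gaussIntegrand χ Complex.cosh β z x ∧
      (Real.sqrt β : ℂ) * Complex.exp (-z ^ 2 / 8) *
          ∫ x in Ioi (0 : ℝ), CharXi.gaussIntegrand χ Complex.cosh β z x =
        1 / (16 * ((Real.pi ^ (3 / 2 : ℝ) : ℝ) : ℂ)) *
          ∫ t in Ioi (0 : ℝ), CharXi.oddXiIntegrand χ α z t) := by
  have hχ := CharXi.isQuadratic_of_im_eq_zero hreal
  have hβα : β * α = 1 := by rw [mul_comm, hαβ]
  -- the `sin` and `cos` sides are the `sinh` and `cosh` sides at `(β, α, iz)`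
  have hexp : Complex.exp (-(z * Complex.I) ^ 2 / 8) = Complex.exp (z ^ 2 / 8) := by
    rw [mul_pow, Complex.I_sq, mul_neg_one, neg_neg]
  refine ⟨fun he => ?_, fun ho => ?_⟩
  · obtain ⟨h1, h2, h3⟩ := CharXi.integral_sinh_eq hq hχ hprim he hα hβ hαβ z
    obtain ⟨h4, -, h6⟩ :=
      CharXi.integral_sinh_eq hq hχ hprim he hβ hα hβα (z * Complex.I)
    have hsin : CharXi.gaussIntegrand χ Complex.sinh α (z * Complex.I) =
        fun x => Complex.I * CharXi.gaussIntegrand χ Complex.sin α z x :=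
      funext (CharXi.gaussIntegrand_sinh_mul_I χ α z)
    have hX : CharXi.evenXiIntegrand χ β (z * Complex.I) = CharXi.evenXiIntegrand χ α z := by
      ext t
      rw [CharXi.evenXiIntegrand, CharXi.evenXiIntegrand, CharXi.Delta_symm hα hβ hαβ]
    rw [hsin] at h4 h6
    rw [hexp, hX, integral_const_mul] at h6
    refine ⟨?_, h1, h2, ?_, h3⟩
    · have := Integrable.const_mul h4 (-Complex.I)
      simpa [← mul_assoc, IntegrableOn] using this
    · rw [h3]
      refine mul_left_cancel₀ Complex.I_ne_zero ?_
      linear_combination h6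
  · obtain ⟨h1, h2, h3⟩ := CharXi.integral_cosh_eq hq hχ hprim ho hα hβ hαβ z
    obtain ⟨h4, -, h6⟩ :=
      CharXi.integral_cosh_eq hq hχ hprim ho hβ hα hβα (z * Complex.I)
    have hcos : CharXi.gaussIntegrand χ Complex.cosh α (z * Complex.I) =
        CharXi.gaussIntegrand χ Complex.cos α z :=
      funext (CharXi.gaussIntegrand_cosh_mul_I χ α z)
    have hX : CharXi.oddXiIntegrand χ β (z * Complex.I) = CharXi.oddXiIntegrand χ α z := by
      ext t
      rw [CharXi.oddXiIntegrand, CharXi.oddXiIntegrand, CharXi.Nabla_symm hα hβ hαβ]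
    rw [hcos] at h4 h6
    rw [hexp, hX] at h6
    exact ⟨h4, h1, h2, by rw [h6, h3], h3⟩
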